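/- Setting. Let $d_1\le\dots\le d_K$ and let $\phi_i:\mathcal X\times\mathcal A\to\mathbb R^{d_i}$ be feature maps such that $\phi_j$ has $\phi_i$ as its first $d_i$ coordinates for $i\le j$. Let $\mathcal F_i=\{(x,a)\mapsto\langle\beta,\phi_i(x,a)\rangle:\beta\in\mathbb R^{d_i}\}$, and let $i^*$ be the smallest index such that the true mean loss $(x,a)\mapsto\langle\beta^*,\phi_{i^*}(x,a)\rangle$, $\beta^*\in\mathbb R^{d_{i^*}}$, belongs to $\mathcal F_{i^*}$. Contexts $x_t$ are i.i.d. When the base learner $\mathcal A_i$ (a randomized contextual bandit algorithm) plays $a$ in the context $x_t$, the observed loss is $\ell_i(x_t,a)+\xi_t$, where $\xi_t$ is zero-mean and sub-Gaussian with variance proxy $1$, $\ell_i\in[0,1]$, and $\ell_i=\langle\beta^*,\phi_{i^*}\rangle$ for all $i\ge i^*$. For the misspecified classes $i<i^*$ the mean loss $\ell_i$ is arbitrary in $[0,1]$, for example $\ell_i=\langle\beta_i,\phi_i\rangle$ for some $\beta_i\in\mathbb R^{d_i}$, or again $\ell_i=\langle\beta^*,\phi_{i^*}\rangle$. Regret is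 measured against $\inf_{a\in\mathcal A}\langle\beta^*,\phi_{i^*}(x_t,a)\rangle$ in each round $t$. A corralling strategy for $K$ base learners selects, in each round, at random and on the basis of its previous selections and observed losses only, a base learner $i_t$, which plays the action $a_{i_t,t}$ that it proposes. The strategy observes the loss of this action, and then sends to each base learner either no feedback (the learner keeps its state), or a (possibly rescaled) loss with which the learner updates, or the command to restart. Theorem. Let $\alpha\ge 0$, $C>0$ and $p\in\mathbb N$. There are constants $C'$ and $p'$, depending on $\alpha$, $C$ and $p$ only, such that for all $T$, all $K\ge1$ and all $d_1,\dots,d_K$ there is a corralling strategy with the following property. Consider any problem as above, with any base learners such that for every $i\ge i^*$ and every $t\le T$ the expected regret of $\mathcal A_i$, run on its own for $t$ rounds, is at most $C\,d_i^{\alpha}\sqrt t\,(1+\log T)^p$. Then the expected regret of the strategy satisfies $$\mathbb E\Big[\sum_{t=1}^T\big(\ell_{i_t}(x_t,a_{i_t,t})-\inf_{a\in\mathcal A}\langle\beta^*,\phi_{i^*}(x_t,a)\rangle\big)\Big]\le C'\big(d_{i^*}^{2\alpha}\sqrt T+K\sqrt T\big)(1+\log T)^{p'}.$$ Moreover, if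 for every $i<i^*$ and all $(x,a)\in\mathcal X\times\mathcal A$ $$\ell_i(x,a)-\inf_{a'\in\mathcal A}\langle\beta^*,\phi_{i^*}(x,a')\rangle\ \ge\ 2\,\frac{d_{i^*}^{2\alpha}-d_i^{2\alpha}}{\sqrt T},$$ then the expected regret of the same strategy is at most $C'\big(d_{i^*}^{\alpha}\sqrt T+K\sqrt T\big)(1+\log T)^{p'}$. -/

import Mathlib

open MeasureTheory ProbabilityTheory

universe u v w

noncomputable section

namespace ModelSelection

/-! ### Product kernels -/

/-- The kernel that draws the coordinates `b i`, `i : ι`, independently, with `b i ∼ κ i a`. -/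
def piKernel {α : Type*} [MeasurableSpace α] {ι : Type*} [Fintype ι] {β : ι → Type*}
    [∀ i, MeasurableSpace (β i)] (κ : ∀ i, Kernel α (β i)) [∀ i, IsMarkovKernel (κ i)] :
    Kernel α (∀ i, β i) where
  toFun a := Measure.pi fun i => κ i a
  measurable' := by
    refine Measurable.measure_of_isPiSystem_of_isProbabilityMeasure
      generateFrom_pi.symm isPiSystem_pi ?_
    rintro s ⟨t, ht, rfl⟩
    simp only [Measure.pi_pi]
    exact Finset.measurable_prod _ fun i _ =>
      (κ i).measurable_coe (ht i (Set.mem_univ i))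

instance {α : Type*} [MeasurableSpace α] {ι : Type*} [Fintype ι] {β : ι → Type*}
    [∀ i, MeasurableSpace (β i)] (κ : ∀ i, Kernel α (β i)) [∀ i, IsMarkovKernel (κ i)] :
    IsMarkovKernel (piKernel κ) :=
  ⟨fun a => inferInstanceAs (IsProbabilityMeasure (Measure.pi fun i => κ i a))⟩

/-! ### The model selection problem for linear bandits -/

/-- The class of linear functions `(x, a) ↦ ⟨β, φ(x, a)⟩`, `β ∈ ℝⁿ`, of a feature map `φ`. -/
def linearClass {X : Type u} {A : Type v} {n : ℕ} (φ : X → A → EuclideanSpace ℝ (Fin n)) :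
    Set (X → A → ℝ) :=
  {f | ∃ β : EuclideanSpace ℝ (Fin n), ∀ x a, f x a = inner ℝ β (φ x a)}

/-- A stochastic linear bandit with nested feature maps of dimensions `d 0 ≤ d 1 ≤ …`.

`loss (i, x, a)` is the law of the loss that is observed when the base learner `i` plays the
action `a` in the context `x`. Its mean is `⟨β*, φ_{i*}(x, a)⟩` if `i* ≤ i`; for `i < i*`
(misspecified classes) the mean is an arbitrary number in `[0, 1]`. In particular, it
may be the same function `⟨β*, φ_{i*}(x, a)⟩` as for the other learners, and it may be of the form
`⟨β_i, φ_i(x, a)⟩` for some parameter `β_i`. -/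
structure Problem (X : Type u) (A : Type v) [MeasurableSpace X] [MeasurableSpace A]
    {K : ℕ} (d : Fin K → ℕ) where
  /-- the law of the contexts -/
  context : Measure X
  isProbabilityMeasure_context : IsProbabilityMeasure context
  /-- the feature maps -/
  feature : (i : Fin K) → X → A → EuclideanSpace ℝ (Fin (d i))
  dim_mono : Monotone d
  /-- for `i ≤ j`, the first `d i` coordinates of the `j`-th feature map are the `i`-th one -/
  nested : ∀ (i j : Fin K) (hij : i ≤ j) (x : X) (a : A) (k : Fin (d i)),
    feature j x a (Fin.castLE (dim_mono hij) k) = feature i x a k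
  /-- the smallest index of a class that contains the true mean loss -/
  iStar : Fin K
  /-- the optimal parameter -/
  betaStar : EuclideanSpace ℝ (Fin (d iStar))
  minimal : ∀ i < iStar,
    (fun x a => inner ℝ betaStar (feature iStar x a)) ∉ linearClass (feature i)
  /-- the law of the observed loss, given the learner, the context and the action -/
  loss : Kernel (Fin K × X × A) ℝ
  isMarkovKernel_loss : IsMarkovKernel loss
  mean_of_le : ∀ i, iStar ≤ i → ∀ x a,
    ∫ y, y ∂(loss (i, x, a)) = inner ℝ betaStar (feature iStar x a)
  mean_mem : ∀ i x a, ∫ y, y ∂(loss (i, x, a)) ∈ Set.Icc (0 : ℝ) 1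
  /-- the noise is sub-Gaussian with variance proxy `1` -/
  subgaussian : ∀ i x a,
    HasSubgaussianMGF (fun y => y - ∫ z, z ∂(loss (i, x, a))) 1 (loss (i, x, a))
  measurable_best : Measurable fun x => ⨅ a, inner ℝ betaStar (feature iStar x a)

attribute [instance] Problem.isProbabilityMeasure_context Problem.isMarkovKernel_loss

/-- A base learner, that is, a randomized contextual bandit algorithm: in the state `s` and the
context `x` it proposes an action `a ∼ act (s, x)`, and when it receives the feedback `y` for the
pair `(x, a)`, it moves to a new state drawn from `update (s, (x, a), y)`. -/
structure BaseLearner (X : Type u) (A : Type v) [MeasurableSpace X] [MeasurableSpace A] where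
  /-- the internal states, for example the histories of the learner -/
  State : Type w
  measurableSpace : MeasurableSpace State
  /-- the law of the initial state -/
  init : Measure State
  isProbabilityMeasure_init : IsProbabilityMeasure init
  act : Kernel (State × X) A
  isMarkovKernel_act : IsMarkovKernel act
  update : Kernel (State × (X × A) × ℝ) State
  isMarkovKernel_update : IsMarkovKernel update

attribute [instance] BaseLearner.measurableSpace BaseLearner.isProbabilityMeasure_init
  BaseLearner.isMarkovKernel_act BaseLearner.isMarkovKernel_update

/-- What a corralling strategy can tell a base learner at the end of a round: nothing, to
start anew, or to update with a given loss for the action that it proposed. -/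
inductive Command
  | skip
  | restart
  | feedback

instance : MeasurableSpace Command := ⊤

instance : DiscreteMeasurableSpace Command := ⟨fun _ => trivial⟩

instance : Countable Command :=
  ⟨fun c => Command.casesOn c 0 1 2, by
    intro a b h
    cases a <;> cases b <;> simp_all⟩

/-- A message to a base learner: a command, and the loss that is reported to the learner (which is
read only if the command is `feedback`). The reported loss may be a rescaled one. -/
abbrev Message : Type := Command × ℝ

/-- A randomized corralling strategy for `K` base learners. In the state `s` it selects the base
learner `i ∼ select s`; it then observes only the loss `y` of the action that this learner plays
(neither the context nor the actions), and draws its new state and the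
messages to all the base learners from `update (s, i, y)`. -/
structure Strategy (K : ℕ) where
  /-- the internal states, for example the histories of selections and losses -/
  State : Type
  measurableSpace : MeasurableSpace State
  /-- the law of the initial state -/
  init : Measure State
  isProbabilityMeasure_init : IsProbabilityMeasure init
  select : Kernel State (Fin K)
  isMarkovKernel_select : IsMarkovKernel select
  update : Kernel (State × Fin K × ℝ) (State × (Fin K → Message))
  isMarkovKernel_update : IsMarkovKernel update

attribute [instance] Strategy.measurableSpace Strategy.isProbabilityMeasure_init
  Strategy.isMarkovKernel_select Strategy.isMarkovKernel_update

namespace Problem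

variable {X : Type u} {A : Type v} [MeasurableSpace X] [MeasurableSpace A] {K : ℕ} {d : Fin K → ℕ}

/-- The mean loss when the base learner `i` plays the action `a` in the context `x`. -/
def mean (P : Problem X A d) (i : Fin K) (x : X) (a : A) : ℝ := ∫ y, y ∂(P.loss (i, x, a))

/-- The smallest mean loss in the context `x`. -/
def best (P : Problem X A d) (x : X) : ℝ :=
  ⨅ a, inner ℝ P.betaStar (P.feature P.iStar x a)

/-- The gap assumption on the misspecified classes. -/
def Gap (P : Problem X A d) (α : ℝ) (T : ℕ) : Prop :=
  ∀ i < P.iStar, ∀ x a,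
    2 * ((d P.iStar : ℝ) ^ (2 * α) - (d i : ℝ) ^ (2 * α)) / √T ≤ P.mean i x a - P.best x

end Problem

/-! ### A base learner on its own -/

section Solo

variable {X : Type u} {A : Type v} [MeasurableSpace X] [MeasurableSpace A] {K : ℕ} {d : Fin K → ℕ}

/-- The context and the action of a round, given the state of the learner. -/
def soloPlay (P : Problem X A d) (L : BaseLearner.{u, v, w} X A) : Kernel L.State (X × A) :=
  Kernel.const L.State P.context ⊗ₖ L.act

/-- The observed loss of the round, in addition. -/
def soloRound (P : Problem X A d) (i : Fin K) (L : BaseLearner.{u, v, w} X A) :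
    Kernel L.State ((X × A) × ℝ) :=
  soloPlay P L ⊗ₖ P.loss.comap (fun p : L.State × (X × A) => (i, p.2)) (by fun_prop)

/-- The transition kernel of the learner when it receives its own observed loss as feedback. -/
def soloStep (P : Problem X A d) (i : Fin K) (L : BaseLearner.{u, v, w} X A) :
    Kernel L.State L.State :=
  (soloRound P i L ⊗ₖ L.update).snd

/-- The law of the state of the learner after `t` rounds. -/
def soloLaw (P : Problem X A d) (i : Fin K) (L : BaseLearner.{u, v, w} X A) : ℕ → Measure L.State
  | 0 => L.init
  | t + 1 => (soloLaw P i L t).bind (soloStep P i L)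

/-- The expected regret over `t` rounds of the base learner `L` (with index `i`) on its own. -/
def soloRegret (P : Problem X A d) (i : Fin K) (L : BaseLearner.{u, v, w} X A) (t : ℕ) : ℝ :=
  ∑ s ∈ Finset.range t,
    ∫ z, (P.mean i z.2.1 z.2.2 - P.best z.2.1) ∂(soloLaw P i L s ⊗ₘ soloPlay P L)

end Solo

/-! ### Corralling -/

section Corral

variable {X : Type u} {A : Type v} [MeasurableSpace X] [MeasurableSpace A] {K : ℕ} {d : Fin K → ℕ}

/-- The reaction of a base learner, with its proposal `(x, a)` of the round, to a message. -/
def respond (L : BaseLearner.{u, v, w} X A) :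
    Kernel ((L.State × (X × A)) × Message) L.State where
  toFun p :=
    match p.2.1 with
    | Command.skip => Measure.dirac p.1.1
    | Command.restart => L.init
    | Command.feedback => L.update (p.1.1, p.1.2, p.2.2)
  measurable' := by
    have h : Measurable fun q : ((L.State × (X × A)) × ℝ) × Command =>
        (match q.2 with
        | Command.skip => Measure.dirac q.1.1.1
        | Command.restart => L.init
        | Command.feedback => L.update (q.1.1.1, q.1.1.2, q.1.2) : Measure L.State) := by
      refine measurable_from_prod_countable_left fun c => ?_
      cases c with
      | skip => exact Measure.measurable_dirac.comp (by fun_prop)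
      | restart => exact measurable_const
      | feedback => exact L.update.measurable.comp (by fun_prop)
    have hg : Measurable fun p : (L.State × (X × A)) × Message => ((p.1, p.2.2), p.2.1) := by
      fun_prop
    exact h.comp hg

instance (L : BaseLearner.{u, v, w} X A) : IsMarkovKernel (respond L) := by
  refine ⟨fun p => ?_⟩
  obtain ⟨⟨s, z⟩, c, y⟩ := p
  cases c
  · exact inferInstanceAs (IsProbabilityMeasure (Measure.dirac s))
  · exact inferInstanceAs (IsProbabilityMeasure L.init)
  · exact inferInstanceAs (IsProbabilityMeasure (L.update (s, z, y)))

/-- The joint states of the base learners and the corralling strategy. -/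
abbrev JointState (L : Fin K → BaseLearner.{u, v, w} X A) (S : Strategy K) : Type w :=
  (∀ i, (L i).State) × S.State

/-- The context of a round and the actions that the base learners propose. -/
def corralProposals (P : Problem X A d) (L : Fin K → BaseLearner.{u, v, w} X A) (S : Strategy K) :
    Kernel (JointState L S) (X × (Fin K → A)) :=
  Kernel.const (JointState L S) P.context ⊗ₖ
    piKernel fun i => (L i).act.comap
      (fun p : JointState L S × X => (p.1.1 i, p.2)) (by fun_prop)

/-- In addition, the base learner that the strategy selects. -/
def corralPlay (P : Problem X A d) (L : Fin K → BaseLearner.{u, v, w} X A) (S : Strategy K) :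
    Kernel (JointState L S) ((X × (Fin K → A)) × Fin K) :=
  corralProposals P L S ⊗ₖ
    S.select.comap (fun p : JointState L S × (X × (Fin K → A)) => p.1.2) (by fun_prop)

lemma measurable_played : Measurable fun q : (X × (Fin K → A)) × Fin K =>
    ((q.2, q.1.1, q.1.2 q.2) : Fin K × X × A) :=
  measurable_from_prod_countable_left fun i =>
    measurable_const.prodMk (measurable_fst.prodMk ((measurable_pi_apply i).comp measurable_snd))

/-- In addition, the observed loss of the action of the selected base learner. -/
def corralRound (P : Problem X A d) (L : Fin K → BaseLearner.{u, v, w} X A) (S : Strategy K) :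
    Kernel (JointState L S) (((X × (Fin K → A)) × Fin K) × ℝ) :=
  corralPlay P L S ⊗ₖ
    P.loss.comap (fun p : JointState L S × ((X × (Fin K → A)) × Fin K) =>
        ((p.2.2, p.2.1.1, p.2.1.2 p.2.2) : Fin K × X × A))
      (measurable_played.comp measurable_snd)

/-- In addition, the new state of the strategy and its messages to the base learners. -/
def corralMessages (P : Problem X A d) (L : Fin K → BaseLearner.{u, v, w} X A) (S : Strategy K) :
    Kernel (JointState L S)
      ((((X × (Fin K → A)) × Fin K) × ℝ) × (S.State × (Fin K → Message))) :=
  corralRound P L S ⊗ₖ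
    S.update.comap (fun p : JointState L S × (((X × (Fin K → A)) × Fin K) × ℝ) =>
      (p.1.2, p.2.1.2, p.2.2)) (by fun_prop)

/-- The transition kernel of the joint state: the base learners react to their messages. -/
def corralStep (P : Problem X A d) (L : Fin K → BaseLearner.{u, v, w} X A) (S : Strategy K) :
    Kernel (JointState L S) (JointState L S) :=
  (corralMessages P L S ⊗ₖ
    piKernel fun i => (respond (L i)).comap
      (fun p : JointState L S ×
          ((((X × (Fin K → A)) × Fin K) × ℝ) × (S.State × (Fin K → Message))) =>
        ((p.1.1 i, (p.2.1.1.1.1, p.2.1.1.1.2 i)), p.2.2.2 i)) (by fun_prop)).map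
    fun q => (q.2, q.1.2.1)

/-- The law of the joint state after `t` rounds. -/
def corralLaw (P : Problem X A d) (L : Fin K → BaseLearner.{u, v, w} X A) (S : Strategy K) :
    ℕ → Measure (JointState L S)
  | 0 => (Measure.pi fun i => (L i).init).prod S.init
  | t + 1 => (corralLaw P L S t).bind (corralStep P L S)

/-- The expected regret over `T` rounds of the corralling strategy `S` with base learners `L`. -/
def corralRegret (P : Problem X A d) (L : Fin K → BaseLearner.{u, v, w} X A) (S : Strategy K)
    (T : ℕ) : ℝ :=
  ∑ t ∈ Finset.range T,
    ∫ z, (P.mean z.2.2 z.2.1.1 (z.2.1.2 z.2.2) - P.best z.2.1.1)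
      ∂(corralLaw P L S t ⊗ₘ corralPlay P L S)

end Corral

end ModelSelection

end

/-
Explore, then commit. The arm `j` stands for the base learners of order `d ^ α < 2 ^ (j + 1)` and
plays the largest of them, so that all arms from that of `i*` on are well specified. In phase `b`
the strategy runs the larger arms in independent restarted blocks that are so short that each of
them costs no more than running the arm `b` itself, and then commits to the arm `b`. The average
loss of a block, plus a confidence radius, is with probability at least one half an upper bound
`W` of the optimal value, and the smallest of these bounds becomes accurate. As soon as the losses
of a block exceed `W` by the threshold `thr j`, the arm `j` is abandoned and phase `j + 1` starts.

For a well-specified arm, an exponential supermartingale bounds the probability of such a false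
alarm by the ratio of the regret to the threshold, and the threshold is so large that, weighted by
this probability, the more expensive later phases cost no more than the current one. A misspecified
arm with an accurate `W` either is detected after a regret of the order of the threshold or has a
drift below the accuracy of `W`. Without a gap this accuracy is of order `4 ^ k / √T`, where `k` is
the arm of `i*`; under the gap assumption every misspecified arm whose order is well below `2 ^ k`
has a larger drift than twice the accuracy.
-/

noncomputable section

namespace ModelSelection

/-! ### Bounded measurable functions -/

section Bounded

variable {α β γ : Type*} [MeasurableSpace α] [MeasurableSpace β] [MeasurableSpace γ]

lemma integrable_of_abs_le {μ : Measure α} [IsFiniteMeasure μ] {f : α → ℝ} (hf : Measurable f)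
    {B : ℝ} (hB : ∀ x, |f x| ≤ B) : Integrable f μ :=
  .of_bound hf.aestronglyMeasurable B (.of_forall hB)

lemma abs_integral_le_of_abs_le {μ : Measure α} [IsProbabilityMeasure μ] {f : α → ℝ} {B : ℝ}
    (hB : ∀ x, |f x| ≤ B) : |∫ x, f x ∂μ| ≤ B := by
  simpa using norm_integral_le_of_norm_le_const (μ := μ) (f := f) (.of_forall hB)

lemma measurable_integral_kernel (κ : Kernel α β) [IsSFiniteKernel κ] {f : β → ℝ}
    (hf : Measurable f) : Measurable fun a => ∫ b, f b ∂(κ a) :=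
  (hf.stronglyMeasurable.integral_kernel (κ := κ)).measurable

lemma integral_bind_of_abs_le {μ : Measure α} [IsProbabilityMeasure μ] (κ : Kernel α β)
    [IsMarkovKernel κ] {f : β → ℝ} (hf : Measurable f) {B : ℝ} (hB : ∀ x, |f x| ≤ B) :
    ∫ b, f b ∂(μ.bind κ) = ∫ a, ∫ b, f b ∂(κ a) ∂μ := by
  rw [← Measure.snd_compProd, Measure.snd,
    integral_map measurable_snd.aemeasurable hf.aestronglyMeasurable]
  exact Measure.integral_compProd (integrable_of_abs_le (hf.comp measurable_snd) fun x => hB _)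

variable (κ : Kernel α β) (η : Kernel (α × β) γ) [IsMarkovKernel κ] [IsMarkovKernel η] (a : α)
  {f : β × γ → ℝ} {B : ℝ}

lemma integral_compProd_of_abs_le (hf : Measurable f) (hB : ∀ z, |f z| ≤ B) :
    ∫ z, f z ∂((κ ⊗ₖ η) a) = ∫ b, ∫ c, f (b, c) ∂(η (a, b)) ∂(κ a) :=
  integral_compProd (integrable_of_abs_le hf hB)

lemma integral_compProd_dirac {g : β → γ} (hg : ∀ b, η (a, b) = Measure.dirac (g b))
    (hf : Measurable f) (hB : ∀ z, |f z| ≤ B) :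
    ∫ z, f z ∂((κ ⊗ₖ η) a) = ∫ b, f (b, g b) ∂(κ a) := by
  rw [integral_compProd_of_abs_le κ η a hf hB]
  refine integral_congr_ae (.of_forall fun b => ?_)
  simp only [hg]
  exact integral_dirac' _ _ (hf.comp measurable_prodMk_left).stronglyMeasurable

end Bounded

lemma pi_eq_map_update {ι : Type*} [Fintype ι] [DecidableEq ι] {β : ι → Type*}
    [∀ i, MeasurableSpace (β i)] (μ : ∀ i, Measure (β i)) [∀ i, IsProbabilityMeasure (μ i)]
    (s : ∀ i, β i) (i : ι) (h : ∀ j ≠ i, μ j = Measure.dirac (s j)) :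
    Measure.pi μ = (μ i).map (Function.update s i) := by
  refine Measure.pi_eq fun t ht => ?_
  rw [Measure.map_apply (measurable_update s) (.univ_pi ht),
    ← Finset.mul_prod_erase Finset.univ _ (Finset.mem_univ i)]
  by_cases hs : ∀ j ≠ i, s j ∈ t j
  · rw [Set.update_preimage_univ_pi hs, Finset.prod_eq_one, mul_one]
    intro j hj
    have hj := Finset.ne_of_mem_erase hj
    rw [h j hj, Measure.dirac_apply' _ (ht j)]
    simp [hs j hj]
  · push Not at hs
    obtain ⟨j, hj, hjt⟩ := hs
    have hpre : Function.update s i ⁻¹' Set.univ.pi t = ∅ :=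
      Set.eq_empty_of_forall_notMem fun x hx => hjt <| by
        simpa [hj] using Set.mem_univ_pi.1 hx j
    rw [hpre, measure_empty, Finset.prod_eq_zero (i := j), mul_zero]
    · simp [hj]
    · rw [h j hj, Measure.dirac_apply' _ (ht j)]
      simp [hjt]

/-! ### Sub-Gaussian variables -/

section Subgaussian

variable {α β : Type*} [MeasurableSpace α] [MeasurableSpace β] {μ : Measure α}

open scoped NNReal

lemma hasSubgaussianMGF_add_compProd [SFinite μ] {κ : Kernel α β} [IsMarkovKernel κ]
    {X : α → ℝ} {Y : α × β → ℝ} {cX cY : ℝ≥0} (hX : HasSubgaussianMGF X cX μ)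
    (hXm : Measurable X) (hYm : Measurable Y)
    (hY : ∀ a, HasSubgaussianMGF (fun b => Y (a, b)) cY (κ a)) :
    HasSubgaussianMGF (fun p => X p.1 + Y p) (cX + cY) (μ ⊗ₘ κ) := by
  have hinner (t : ℝ) (a : α) : ∫ b, Real.exp (t * (X a + Y (a, b))) ∂(κ a) ≤
      Real.exp (t * X a) * Real.exp (cY * t ^ 2 / 2) := by
    simp only [mul_add, Real.exp_add, integral_const_mul]
    exact mul_le_mul_of_nonneg_left ((hY a).mgf_le t) (Real.exp_nonneg _)
  have hint (t : ℝ) : Integrable (fun p => Real.exp (t * (X p.1 + Y p))) (μ ⊗ₘ κ) := by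
    have hm : Measurable fun p => Real.exp (t * (X p.1 + Y p)) := by fun_prop
    rw [Measure.integrable_compProd_iff hm.aestronglyMeasurable]
    refine ⟨.of_forall fun a => ?_, ((hX.integrable_exp_mul t).mul_const
      (Real.exp (cY * t ^ 2 / 2))).mono' ?_ (.of_forall fun a => ?_)⟩
    · simp only [mul_add, Real.exp_add]
      exact ((hY a).integrable_exp_mul t).const_mul _
    · exact hm.norm.stronglyMeasurable.integral_kernel_prod_right'.aestronglyMeasurable
    · simp only [Real.norm_eq_abs, Real.abs_exp]
      rw [abs_of_nonneg (integral_nonneg fun _ => Real.exp_nonneg _)]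
      exact hinner t a
  refine ⟨hint, fun t => ?_⟩
  calc mgf (fun p => X p.1 + Y p) (μ ⊗ₘ κ) t
      = ∫ a, ∫ b, Real.exp (t * (X a + Y (a, b))) ∂(κ a) ∂μ := Measure.integral_compProd (hint t)
    _ ≤ ∫ a, Real.exp (t * X a) * Real.exp (cY * t ^ 2 / 2) ∂μ :=
        integral_mono_of_nonneg (.of_forall fun a => integral_nonneg fun _ => Real.exp_nonneg _)
          ((hX.integrable_exp_mul t).mul_const _) (.of_forall (hinner t))
    _ ≤ Real.exp (cX * t ^ 2 / 2) * Real.exp (cY * t ^ 2 / 2) := by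
        rw [integral_mul_const]
        exact mul_le_mul_of_nonneg_right (hX.mgf_le t) (Real.exp_nonneg _)
    _ = Real.exp ((cX + cY : ℝ≥0) * t ^ 2 / 2) := by
        rw [← Real.exp_add, NNReal.coe_add]; ring_nf

lemma sq_le_two_mul_exp_add_exp_neg (x : ℝ) : x ^ 2 ≤ 2 * (Real.exp x + Real.exp (-x)) := by
  have h : x ^ 2 / 2 ≤ Real.exp |x| := by
    simpa using Real.pow_div_factorial_le_exp |x| (abs_nonneg x) 2
  rcases abs_choice x with h' | h' <;> rw [h'] at h <;>
    linarith [Real.exp_pos x, Real.exp_pos (-x)]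

lemma integral_sq_le_of_hasSubgaussianMGF {X : α → ℝ} {c : ℝ≥0} (hX : HasSubgaussianMGF X c μ) :
    ∫ a, X a ^ 2 ∂μ ≤ 4 * Real.exp (c / 2) := by
  have h₁ : ∫ a, Real.exp (X a) ∂μ ≤ Real.exp (c / 2) := by simpa [mgf] using hX.mgf_le 1
  have h₂ : ∫ a, Real.exp (-X a) ∂μ ≤ Real.exp (c / 2) := by simpa [mgf] using hX.mgf_le (-1)
  have i₁ : Integrable (fun a => Real.exp (X a)) μ := by simpa using hX.integrable_exp_mul 1
  have i₂ : Integrable (fun a => Real.exp (-X a)) μ := by simpa using hX.integrable_exp_mul (-1)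
  calc ∫ a, X a ^ 2 ∂μ ≤ ∫ a, 2 * (Real.exp (X a) + Real.exp (-X a)) ∂μ :=
        integral_mono_of_nonneg (.of_forall fun a => sq_nonneg _) ((i₁.add i₂).const_mul 2)
          (.of_forall fun a => sq_le_two_mul_exp_add_exp_neg (X a))
    _ = 2 * (∫ a, Real.exp (X a) ∂μ + ∫ a, Real.exp (-X a) ∂μ) := by
        rw [integral_const_mul, integral_add i₁ i₂]
    _ ≤ 4 * Real.exp (c / 2) := by linarith

end Subgaussian

/-! ### Accumulated costs along a Markov chain -/

/-- The expected cost accumulated over `r` rounds of the Markov chain with kernel `κ` that starts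
in `z`, when each visit of a state `z'` costs `g z'`. Recursive analysis of the expected regret
rests on it. -/
def costToGo {Z : Type*} [MeasurableSpace Z] (g : Z → ℝ) (κ : Kernel Z Z) : ℕ → Z → ℝ
  | 0 => fun _ => 0
  | r + 1 => fun z => g z + ∫ z', costToGo g κ r z' ∂(κ z)

section Chain

variable {Z : Type*} [MeasurableSpace Z] {g : Z → ℝ} {κ : Kernel Z Z}

lemma costToGo_nonneg (hg : ∀ z, 0 ≤ g z) (r : ℕ) (z : Z) : 0 ≤ costToGo g κ r z := by
  induction r generalizing z with
  | zero => exact le_rfl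
  | succ r ih => exact add_nonneg (hg z) (integral_nonneg ih)

variable [IsMarkovKernel κ]

lemma measurable_costToGo (hg : Measurable g) (r : ℕ) : Measurable (costToGo g κ r) := by
  induction r with
  | zero => exact measurable_const
  | succ r ih => exact hg.add (measurable_integral_kernel κ ih)

lemma abs_costToGo_le {B : ℝ} (hB : ∀ z, |g z| ≤ B) (r : ℕ) (z : Z) :
    |costToGo g κ r z| ≤ r * B := by
  induction r generalizing z with
  | zero => simp [costToGo]
  | succ r ih =>
    calc |costToGo g κ (r + 1) z| ≤ |g z| + |∫ z', costToGo g κ r z' ∂(κ z)| := abs_add_le _ _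
      _ ≤ B + r * B := add_le_add (hB z) (abs_integral_le_of_abs_le ih)
      _ = (r + 1 : ℕ) * B := by push_cast; ring

lemma sum_integral_eq_integral_costToGo (hg : Measurable g) {B : ℝ} (hB : ∀ z, |g z| ≤ B)
    (μ : ℕ → Measure Z) [IsProbabilityMeasure (μ 0)] (hμ : ∀ t, μ (t + 1) = (μ t).bind κ) (r : ℕ) :
    ∑ t ∈ Finset.range r, ∫ z, g z ∂(μ t) = ∫ z, costToGo g κ r z ∂(μ 0) := by
  induction r generalizing μ with
  | zero => simp [costToGo]
  | succ r ih =>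
    have : IsProbabilityMeasure (μ (0 + 1)) := by rw [hμ]; infer_instance
    have hV := measurable_costToGo (κ := κ) hg r
    have hVB := abs_costToGo_le (κ := κ) hB r
    calc ∑ t ∈ Finset.range (r + 1), ∫ z, g z ∂(μ t)
        = ∫ z, g z ∂(μ 0) + ∑ t ∈ Finset.range r, ∫ z, g z ∂(μ (t + 1)) := by
          rw [Finset.sum_range_succ', add_comm]
      _ = ∫ z, g z ∂(μ 0) + ∫ z, ∫ z', costToGo g κ r z' ∂(κ z) ∂(μ 0) := by
          rw [ih (fun t => μ (t + 1)) fun t => hμ (t + 1), hμ, integral_bind_of_abs_le κ hV hVB]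
      _ = ∫ z, costToGo g κ (r + 1) z ∂(μ 0) :=
          (integral_add (integrable_of_abs_le hg hB) (integrable_of_abs_le
            (measurable_integral_kernel κ hV) fun _ => abs_integral_le_of_abs_le hVB)).symm

end Chain

/-! ### The mean losses -/

namespace Problem

variable {X : Type u} {A : Type v} [MeasurableSpace X] [MeasurableSpace A] {K : ℕ} {d : Fin K → ℕ}
  (P : Problem X A d)

/-- The expected smallest mean loss: what the best policy loses per round, and the quantity that
the corralling strategy estimates. -/
def value : ℝ := ∫ x, P.best x ∂P.context

lemma measurable_mean : Measurable fun p : Fin K × X × A => P.mean p.1 p.2.1 p.2.2 :=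
  measurable_integral_kernel P.loss measurable_id

lemma measurable_mean_right (i : Fin K) : Measurable fun p : X × A => P.mean i p.1 p.2 :=
  P.measurable_mean.comp (measurable_const.prodMk measurable_id)

lemma mean_mem_Icc (i : Fin K) (x : X) (a : A) : P.mean i x a ∈ Set.Icc (0 : ℝ) 1 :=
  P.mean_mem i x a

lemma best_eq_iInf_mean {i : Fin K} (hi : P.iStar ≤ i) (x : X) : P.best x = ⨅ a, P.mean i x a :=
  iInf_congr fun a => (P.mean_of_le i hi x a).symm

lemma best_nonneg (x : X) : 0 ≤ P.best x := by
  rw [P.best_eq_iInf_mean le_rfl]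
  exact Real.iInf_nonneg fun a => (P.mean_mem_Icc _ x a).1

lemma best_le_mean {i : Fin K} (hi : P.iStar ≤ i) (x : X) (a : A) : P.best x ≤ P.mean i x a := by
  rw [P.best_eq_iInf_mean hi]
  exact ciInf_le ⟨0, by rintro _ ⟨b, rfl⟩; exact (P.mean_mem_Icc _ x b).1⟩ a

lemma best_le_one (x : X) : P.best x ≤ 1 := by
  rcases isEmpty_or_nonempty A with h | ⟨⟨a⟩⟩
  · simp [best, Real.iInf_of_isEmpty]
  · exact (P.best_le_mean le_rfl x a).trans (P.mean_mem_Icc _ x a).2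

lemma abs_best_le (x : X) : |P.best x| ≤ 1 :=
  abs_le.2 ⟨by linarith [P.best_nonneg x], P.best_le_one x⟩

lemma abs_mean_sub_best_le (i : Fin K) (x : X) (a : A) : |P.mean i x a - P.best x| ≤ 1 := by
  have h := P.mean_mem_Icc i x a
  exact abs_le.2 ⟨by linarith [h.1, P.best_le_one x], by linarith [h.2, P.best_nonneg x]⟩

lemma value_le_one : P.value ≤ 1 := (abs_le.1 (abs_integral_le_of_abs_le P.abs_best_le)).2

lemma hasSubgaussianMGF_best :
    HasSubgaussianMGF (fun x => P.best x - P.value) (1 / 4) P.context := by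
  have h := hasSubgaussianMGF_of_mem_Icc (μ := P.context) (X := P.best) (a := 0) (b := 1)
    P.measurable_best.aemeasurable (.of_forall fun x => ⟨P.best_nonneg x, P.best_le_one x⟩)
  rwa [show (‖(1 : ℝ) - 0‖₊ / 2) ^ 2 = 1 / 4 by ext; norm_num] at h

end Problem

/-! ### One round of a base learner -/

section Solo

variable {X : Type u} {A : Type v} [MeasurableSpace X] [MeasurableSpace A] {K : ℕ} {d : Fin K → ℕ}
  (P : Problem X A d) (i : Fin K) (L : BaseLearner.{u, v, w} X A)

instance : IsMarkovKernel (soloPlay P L) := by unfold soloPlay; infer_instance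
instance : IsMarkovKernel (soloRound P i L) := by unfold soloRound; infer_instance
instance : IsMarkovKernel (soloStep P i L) := by unfold soloStep; infer_instance

instance (t : ℕ) : IsProbabilityMeasure (soloLaw P i L t) := by
  induction t with
  | zero => exact L.isProbabilityMeasure_init
  | succ t ih => unfold soloLaw; infer_instance

/-- The expected regret, in a single round, of the learner in the state `s`; the cost in the
Markov chain of the states of the learner. -/
def roundRegret (s : L.State) : ℝ := ∫ z, (P.mean i z.1 z.2 - P.best z.1) ∂(soloPlay P L s)

/-- The expected regret over `t` rounds of the learner on its own, started in the state `s`; it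
refines `soloRegret`, which is its average over the initial states. -/
def regretToGo (t : ℕ) (s : L.State) : ℝ := costToGo (roundRegret P i L) (soloStep P i L) t s

lemma measurable_mean_sub_best : Measurable fun z : X × A => P.mean i z.1 z.2 - P.best z.1 :=
  (P.measurable_mean_right i).sub (P.measurable_best.comp measurable_fst)

lemma measurable_roundRegret : Measurable (roundRegret P i L) :=
  measurable_integral_kernel _ (measurable_mean_sub_best P i)

lemma abs_roundRegret_le (s : L.State) : |roundRegret P i L s| ≤ 1 :=
  abs_integral_le_of_abs_le fun _ => P.abs_mean_sub_best_le i _ _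

lemma measurable_regretToGo (t : ℕ) : Measurable (regretToGo P i L t) :=
  measurable_costToGo (measurable_roundRegret P i L) t

lemma abs_regretToGo_le (t : ℕ) (s : L.State) : |regretToGo P i L t s| ≤ t := by
  simpa [regretToGo] using
    abs_costToGo_le (κ := soloStep P i L) (abs_roundRegret_le P i L) t s

lemma regretToGo_nonneg (hi : P.iStar ≤ i) (t : ℕ) (s : L.State) : 0 ≤ regretToGo P i L t s :=
  costToGo_nonneg (fun _ => integral_nonneg fun _ => sub_nonneg.2 (P.best_le_mean hi _ _)) t s

lemma soloRegret_eq_integral_regretToGo (t : ℕ) :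
    soloRegret P i L t = ∫ s, regretToGo P i L t s ∂L.init := by
  have : IsProbabilityMeasure (soloLaw P i L 0) := inferInstance
  calc soloRegret P i L t
      = ∑ s ∈ Finset.range t, ∫ z, roundRegret P i L z ∂(soloLaw P i L s) :=
        Finset.sum_congr rfl fun _ _ => Measure.integral_compProd <| integrable_of_abs_le
          ((measurable_mean_sub_best P i).comp measurable_snd) fun _ =>
            P.abs_mean_sub_best_le i _ _
    _ = ∫ s, regretToGo P i L t s ∂L.init :=
        sum_integral_eq_integral_costToGo (measurable_roundRegret P i L)
          (abs_roundRegret_le P i L) (soloLaw P i L) (fun _ => rfl) t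

variable (s : L.State)

lemma soloPlay_apply : soloPlay P L s =
    P.context ⊗ₘ L.act.comap (fun x => (s, x)) measurable_prodMk_left :=
  Kernel.compProd_apply_eq_compProd_sectR _ _ _

lemma soloRound_apply : soloRound P i L s =
    soloPlay P L s ⊗ₘ P.loss.comap (fun z => (i, z)) measurable_prodMk_left :=
  Kernel.compProd_apply_eq_compProd_sectR _ _ _

lemma map_fst_soloPlay : (soloPlay P L s).map Prod.fst = P.context := by
  rw [soloPlay_apply]
  exact Measure.fst_compProd _ _

lemma integral_soloPlay {f : X × A → ℝ} (hf : Measurable f) {B : ℝ} (hB : ∀ z, |f z| ≤ B) :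
    ∫ z, f z ∂(soloPlay P L s) = ∫ x, ∫ a, f (x, a) ∂(L.act (s, x)) ∂P.context := by
  rw [soloPlay_apply]
  exact Measure.integral_compProd (integrable_of_abs_le hf hB)

lemma integral_soloRound {f : (X × A) × ℝ → ℝ} (hf : Integrable f (soloRound P i L s)) :
    ∫ z, f z ∂(soloRound P i L s) = ∫ z, ∫ y, f (z, y) ∂(P.loss (i, z)) ∂(soloPlay P L s) := by
  rw [soloRound_apply] at hf ⊢
  exact Measure.integral_compProd hf

/-- The deviation of the observed loss `z.2` from the optimal value, without the regret that is due
to the action: the fluctuation of the best mean loss plus the noise. -/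
def deviation (z : (X × A) × ℝ) : ℝ :=
  (P.best z.1.1 - P.value) + (z.2 - P.mean i z.1.1 z.1.2)

lemma sub_value_eq_deviation_add (z : (X × A) × ℝ) : z.2 - P.value =
    deviation P i z + (P.mean i z.1.1 z.1.2 - P.best z.1.1) := by
  unfold deviation
  ring

lemma hasSubgaussianMGF_deviation :
    HasSubgaussianMGF (deviation P i) (1 / 4 + 1) (soloRound P i L s) := by
  have hbest : HasSubgaussianMGF (fun z : X × A => P.best z.1 - P.value) (1 / 4)
      (soloPlay P L s) := by
    refine .of_map (Y := Prod.fst) (X := fun x => P.best x - P.value)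
      measurable_fst.aemeasurable ?_
    rw [map_fst_soloPlay]
    exact P.hasSubgaussianMGF_best
  rw [soloRound_apply]
  exact hasSubgaussianMGF_add_compProd hbest
    ((P.measurable_best.comp measurable_fst).sub_const _)
    (measurable_snd.sub ((P.measurable_mean_right i).comp measurable_fst))
    fun z => P.subgaussian i z.1 z.2

lemma memLp_two_sub_value_soloRound :
    MemLp (fun z => z.2 - P.value) 2 (soloRound P i L s) := by
  simp only [sub_value_eq_deviation_add P i]
  refine ((hasSubgaussianMGF_deviation P i L s).memLp 2).add
    (.of_bound ?_ 1 (.of_forall fun z => P.abs_mean_sub_best_le i _ _))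
  exact ((measurable_mean_sub_best P i).comp measurable_fst).aestronglyMeasurable

lemma integrable_sub_value_soloRound :
    Integrable (fun z => z.2 - P.value) (soloRound P i L s) :=
  (memLp_two_sub_value_soloRound P i L s).integrable (by norm_num)

lemma integrable_sq_soloRound : Integrable (fun z => (z.2 - P.value) ^ 2) (soloRound P i L s) :=
  (memLp_two_sub_value_soloRound P i L s).integrable_sq

lemma integral_sq_soloRound_le : ∫ z, (z.2 - P.value) ^ 2 ∂(soloRound P i L s) ≤ 20 := by
  have hdev := hasSubgaussianMGF_deviation P i L s
  have hexp : Real.exp (((1 / 4 + 1 : NNReal) : ℝ) / 2) ≤ 9 / 4 := by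
    refine le_of_pow_le_pow_left₀ (n := 8) (by norm_num) (by norm_num) ?_
    rw [← Real.exp_nat_mul]
    calc Real.exp ((8 : ℕ) * (((1 / 4 + 1 : NNReal) : ℝ) / 2)) = Real.exp 1 ^ 5 := by
          rw [← Real.exp_nat_mul]; norm_num
      _ ≤ 2.7182818286 ^ 5 := by gcongr; exact Real.exp_one_lt_d9.le
      _ ≤ (9 / 4) ^ 8 := by norm_num
  have hint := (hdev.memLp 2).integrable_sq
  calc ∫ z, (z.2 - P.value) ^ 2 ∂(soloRound P i L s)
      ≤ ∫ z, (2 * deviation P i z ^ 2 + 2) ∂(soloRound P i L s) := by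
        refine integral_mono (integrable_sq_soloRound P i L s)
          ((hint.const_mul 2).add (integrable_const 2)) fun z => ?_
        have := P.abs_mean_sub_best_le i z.1.1 z.1.2
        simp only [sub_value_eq_deviation_add P i z]
        nlinarith [sq_nonneg (deviation P i z - (P.mean i z.1.1 z.1.2 - P.best z.1.1)),
          (sq_le_one_iff_abs_le_one _).2 this]
    _ = 2 * ∫ z, deviation P i z ^ 2 ∂(soloRound P i L s) + 2 := by
        rw [integral_add (hint.const_mul 2) (integrable_const _), integral_const_mul]
        simp
    _ ≤ 20 := by linarith [integral_sq_le_of_hasSubgaussianMGF hdev]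

lemma integral_sub_value_soloRound :
    ∫ z, (z.2 - P.value) ∂(soloRound P i L s) = roundRegret P i L s := by
  have hloss (z : X × A) : ∫ y, (y - P.value) ∂(P.loss (i, z)) = P.mean i z.1 z.2 - P.value := by
    have hid : Integrable (fun y => y) (P.loss (i, z)) :=
      ((P.subgaussian i z.1 z.2).integrable.add (integrable_const (P.mean i z.1 z.2))).congr
        (.of_forall fun y => by simp [Problem.mean])
    rw [integral_sub hid (integrable_const _)]
    simp [Problem.mean]
  have hmean : Integrable (fun z : X × A => P.mean i z.1 z.2 - P.best z.1) (soloPlay P L s) :=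
    integrable_of_abs_le (measurable_mean_sub_best P i) fun z => P.abs_mean_sub_best_le i _ _
  have hbest : Integrable (fun z : X × A => P.best z.1) (soloPlay P L s) :=
    integrable_of_abs_le (P.measurable_best.comp measurable_fst) fun z => P.abs_best_le z.1
  have hvalue : ∫ z, P.best z.1 ∂(soloPlay P L s) = P.value := by
    rw [← integral_map (f := P.best) measurable_fst.aemeasurable
      P.measurable_best.aestronglyMeasurable, map_fst_soloPlay]
    rfl
  have hsub : Integrable (fun z : X × A => P.best z.1 - P.value) (soloPlay P L s) :=
    hbest.sub (integrable_const _)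
  calc ∫ z, (z.2 - P.value) ∂(soloRound P i L s)
      = ∫ z, (P.mean i z.1 z.2 - P.value) ∂(soloPlay P L s) := by
        rw [integral_soloRound P i L s (integrable_sub_value_soloRound P i L s)]
        simp only [hloss]
    _ = ∫ z, ((P.mean i z.1 z.2 - P.best z.1) + (P.best z.1 - P.value)) ∂(soloPlay P L s) := by
        simp only [sub_add_sub_cancel]
    _ = roundRegret P i L s := by
        rw [integral_add hmean hsub, integral_sub hbest (integrable_const _), hvalue]
        simp [roundRegret]

variable {i} {t : ℝ}

lemma exp_neg_mul_sub_value_le (hi : P.iStar ≤ i) (ht : 0 ≤ t) (z : (X × A) × ℝ) :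
    Real.exp (-t * (z.2 - P.value)) ≤ Real.exp (-t * deviation P i z) := by
  rw [sub_value_eq_deviation_add P i]
  have := P.best_le_mean hi z.1.1 z.1.2
  exact Real.exp_le_exp.2 (by nlinarith)

lemma integrable_exp_neg_soloRound (hi : P.iStar ≤ i) (ht : 0 ≤ t) :
    Integrable (fun z => Real.exp (-t * (z.2 - P.value))) (soloRound P i L s) :=
  ((hasSubgaussianMGF_deviation P i L s).integrable_exp_mul (-t)).mono' (by fun_prop)
    (.of_forall fun z => by
      rw [Real.norm_eq_abs, Real.abs_exp]
      exact exp_neg_mul_sub_value_le P hi ht z)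

lemma integral_exp_neg_soloRound_le (hi : P.iStar ≤ i) (ht : 0 ≤ t) :
    ∫ z, Real.exp (-t * (z.2 - P.value)) ∂(soloRound P i L s) ≤ Real.exp (t ^ 2) := by
  have hdev := hasSubgaussianMGF_deviation P i L s
  calc ∫ z, Real.exp (-t * (z.2 - P.value)) ∂(soloRound P i L s)
      ≤ mgf (deviation P i) (soloRound P i L s) (-t) :=
        integral_mono (integrable_exp_neg_soloRound P L s hi ht) (hdev.integrable_exp_mul _)
          (exp_neg_mul_sub_value_le P hi ht)
    _ ≤ Real.exp (t ^ 2) := (hdev.mgf_le _).trans <| Real.exp_le_exp.2 <| by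
        norm_num
        nlinarith [sq_nonneg t]

end Solo

/-! ### Corralling as a Markov chain -/

section Corral

variable {X : Type u} {A : Type v} [MeasurableSpace X] [MeasurableSpace A] {K : ℕ} {d : Fin K → ℕ}
  (P : Problem X A d) (L : Fin K → BaseLearner.{u, v, w} X A) (S : Strategy K)

instance : IsMarkovKernel (corralProposals P L S) := by unfold corralProposals; infer_instance
instance : IsMarkovKernel (corralPlay P L S) := by unfold corralPlay; infer_instance
instance : IsMarkovKernel (corralRound P L S) := by unfold corralRound; infer_instance
instance : IsMarkovKernel (corralMessages P L S) := by unfold corralMessages; infer_instance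
instance : IsMarkovKernel (corralStep P L S) := by
  unfold corralStep
  exact Kernel.IsMarkovKernel.map _ (by fun_prop)

instance (t : ℕ) : IsProbabilityMeasure (corralLaw P L S t) := by
  induction t with
  | zero => unfold corralLaw; infer_instance
  | succ t ih => unfold corralLaw; infer_instance

/-- The expected regret, in a single round, of corralling from the joint state `z`; the cost in the
Markov chain of the joint states. -/
def corralRoundRegret (z : JointState L S) : ℝ :=
  ∫ q, (P.mean q.2 q.1.1 (q.1.2 q.2) - P.best q.1.1) ∂(corralPlay P L S z)

/-- The expected regret over `r` rounds of corralling from the joint state `z`; it refines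
`corralRegret`, which is its average over the initial states. -/
def corralRegretToGo (r : ℕ) (z : JointState L S) : ℝ :=
  costToGo (corralRoundRegret P L S) (corralStep P L S) r z

lemma measurable_mean_played_sub_best : Measurable fun q : (X × (Fin K → A)) × Fin K =>
    P.mean q.2 q.1.1 (q.1.2 q.2) - P.best q.1.1 :=
  (P.measurable_mean.comp measurable_played).sub (P.measurable_best.comp (by fun_prop))

lemma measurable_corralRoundRegret : Measurable (corralRoundRegret P L S) :=
  measurable_integral_kernel _ (measurable_mean_played_sub_best P)

lemma abs_corralRoundRegret_le (z : JointState L S) : |corralRoundRegret P L S z| ≤ 1 :=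
  abs_integral_le_of_abs_le fun _ => P.abs_mean_sub_best_le _ _ _

lemma measurable_corralRegretToGo (r : ℕ) : Measurable (corralRegretToGo P L S r) :=
  measurable_costToGo (measurable_corralRoundRegret P L S) r

lemma abs_corralRegretToGo_le (r : ℕ) (z : JointState L S) : |corralRegretToGo P L S r z| ≤ r := by
  simpa [corralRegretToGo] using
    abs_costToGo_le (κ := corralStep P L S) (abs_corralRoundRegret_le P L S) r z

lemma corralRegret_eq_integral_corralRegretToGo (T : ℕ) :
    corralRegret P L S T = ∫ z, corralRegretToGo P L S T z ∂(corralLaw P L S 0) :=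
  calc corralRegret P L S T
      = ∑ t ∈ Finset.range T, ∫ z, corralRoundRegret P L S z ∂(corralLaw P L S t) :=
        Finset.sum_congr rfl fun _ _ => Measure.integral_compProd <| integrable_of_abs_le
          ((measurable_mean_played_sub_best P).comp measurable_snd) fun _ =>
            P.abs_mean_sub_best_le _ _ _
    _ = ∫ z, corralRegretToGo P L S T z ∂(corralLaw P L S 0) :=
        sum_integral_eq_integral_costToGo (measurable_corralRoundRegret P L S)
          (abs_corralRoundRegret_le P L S) (corralLaw P L S) (fun _ => rfl) T

lemma integral_corralProposals (z : JointState L S) (i : Fin K) {f : X × A → ℝ}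
    (hf : Measurable f) {B : ℝ} (hB : ∀ z, |f z| ≤ B) :
    ∫ q, f (q.1, q.2 i) ∂(corralProposals P L S z) = ∫ q, f q ∂(soloPlay P (L i) (z.1 i)) := by
  have hproj (x : X) : ∫ as, f (x, as i) ∂(Measure.pi fun j => (L j).act (z.1 j, x)) =
      ∫ a, f (x, a) ∂((L i).act (z.1 i, x)) := by
    rw [← (measurePreserving_eval (fun j => (L j).act (z.1 j, x)) i).map_eq]
    have hfx : Measurable fun a => f (x, a) := hf.comp measurable_prodMk_left
    exact (integral_map (φ := fun as : Fin K → A => as i) (measurable_pi_apply i).aemeasurable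
      hfx.aestronglyMeasurable).symm
  unfold corralProposals
  rw [integral_soloPlay P (L i) _ hf hB, integral_compProd_of_abs_le _ _ _
    (f := fun q : X × (Fin K → A) => f (q.1, q.2 i)) (hf.comp (by fun_prop)) fun _ => hB _]
  exact integral_congr_ae (.of_forall hproj)

end Corral

/-! ### Block rules -/

/-- A deterministic corralling rule in which the learners change state only by playing, and which
now and then restarts all of them at once. All strategies considered here are of this form. -/
structure BlockRule (K : ℕ) (State : Type) [MeasurableSpace State] where
  start : State
  select : State → Fin K
  measurable_select : Measurable select
  next : State × ℝ → State
  measurable_next : Measurable next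
  restarts : Set (State × ℝ)
  measurableSet_restarts : MeasurableSet restarts

namespace BlockRule

variable {K : ℕ} {State : Type} [m : MeasurableSpace State] (R : BlockRule K State)

open Classical in
/-- The messages of the rule when it is in the state `p.1`, the learner `p.2.1` has been played and
the loss is `p.2.2`. -/
def message (p : State × Fin K × ℝ) (i : Fin K) : Message :=
  if (p.1, p.2.2) ∈ R.restarts then (Command.restart, 0)
  else if i = p.2.1 then (Command.feedback, p.2.2) else (Command.skip, 0)

lemma measurable_message : Measurable R.message := by
  classical
  refine measurable_pi_lambda _ fun i => .ite ?_ measurable_const <|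
    .ite ?_ (by fun_prop) measurable_const
  · exact R.measurableSet_restarts.preimage (by fun_prop)
  · exact measurableSet_eq_fun measurable_const (by fun_prop)

/-- The new state of the rule, together with the messages. -/
def transition (p : State × Fin K × ℝ) : State × (Fin K → Message) :=
  (R.next (p.1, p.2.2), R.message p)

lemma measurable_transition : Measurable R.transition :=
  (R.measurable_next.comp (by fun_prop)).prodMk R.measurable_message

/-- The corralling strategy that follows the rule. -/
def strategy : Strategy K where
  State := State
  measurableSpace := m
  init := Measure.dirac R.start
  isProbabilityMeasure_init := inferInstance
  select := Kernel.deterministic R.select R.measurable_select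
  isMarkovKernel_select := inferInstance
  update := Kernel.deterministic R.transition R.measurable_transition
  isMarkovKernel_update := inferInstance

end BlockRule

section AfterRound

variable {X : Type u} {A : Type v} [MeasurableSpace X] [MeasurableSpace A] {K : ℕ}
  (L : Fin K → BaseLearner.{u, v, w} X A) {State : Type} [MeasurableSpace State]
  (R : BlockRule K State)

/-- The joint law of the initial states of the base learners. -/
abbrev initLaw : Measure (∀ i, (L i).State) := Measure.pi fun i => (L i).init

open Classical in
/-- The expectation of `f` at the joint state after a round that started in `(s, σ)` and in which
the selected learner met the context, action and loss `z`. -/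
def afterRound (f : (∀ i, (L i).State) × State → ℝ) (s : ∀ i, (L i).State) (σ : State)
    (z : (X × A) × ℝ) : ℝ :=
  if (σ, z.2) ∈ R.restarts then ∫ s', f (s', R.next (σ, z.2)) ∂(initLaw L)
  else ∫ s', f (Function.update s (R.select σ) s', R.next (σ, z.2))
    ∂((L (R.select σ)).update (s (R.select σ), z.1, z.2))

variable {f : (∀ i, (L i).State) × State → ℝ}

lemma measurable_afterRound (hf : Measurable f) (s : ∀ i, (L i).State) (σ : State) :
    Measurable (afterRound L R f s σ) := by
  classical
  have hnext : Measurable fun z : (X × A) × ℝ => R.next (σ, z.2) :=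
    R.measurable_next.comp (by fun_prop)
  refine Measurable.ite (R.measurableSet_restarts.preimage (by fun_prop)) ?_ ?_
  · have h : Measurable fun p : ((X × A) × ℝ) × (∀ i, (L i).State) =>
        f (p.2, R.next (σ, p.1.2)) :=
      hf.comp (measurable_snd.prodMk (hnext.comp measurable_fst))
    exact (h.stronglyMeasurable.integral_prod_right' (ν := initLaw L)).measurable
  · have h : Measurable fun p : ((X × A) × ℝ) × (L (R.select σ)).State =>
        f (Function.update s (R.select σ) p.2, R.next (σ, p.1.2)) :=
      hf.comp (((measurable_update s).comp measurable_snd).prodMk (hnext.comp measurable_fst))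
    have hu : Measurable fun z : (X × A) × ℝ => (s (R.select σ), z.1, z.2) := by fun_prop
    exact (h.stronglyMeasurable.integral_kernel_prod_right'
      (κ := (L (R.select σ)).update.comap _ hu)).measurable

lemma abs_afterRound_le {B : ℝ} (hB : ∀ z, |f z| ≤ B) (s : ∀ i, (L i).State) (σ : State)
    (z : (X × A) × ℝ) : |afterRound L R f s σ z| ≤ B := by
  unfold afterRound
  split_ifs <;> exact abs_integral_le_of_abs_le fun _ => hB _

lemma integral_respond (hf : Measurable f) (s : ∀ i, (L i).State) (σ : State) (x : X)
    (as : Fin K → A) (y : ℝ) :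
    ∫ s', f (s', (R.transition (σ, R.select σ, y)).1)
      ∂(Measure.pi fun i => respond (L i)
        ((s i, (x, as i)), (R.transition (σ, R.select σ, y)).2 i)) =
      afterRound L R f s σ ((x, as (R.select σ)), y) := by
  unfold afterRound
  by_cases h : (σ, y) ∈ R.restarts
  · have hrestart : (fun i => respond (L i)
        ((s i, (x, as i)), (R.transition (σ, R.select σ, y)).2 i)) = fun i => (L i).init := by
      funext i
      simp only [BlockRule.transition, BlockRule.message, if_pos h]
      rfl
    rw [if_pos h, hrestart]
    rfl
  · have hplayed : respond (L (R.select σ)) ((s (R.select σ), (x, as (R.select σ))),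
        (R.transition (σ, R.select σ, y)).2 (R.select σ)) =
        (L (R.select σ)).update (s (R.select σ), (x, as (R.select σ)), y) := by
      simp only [BlockRule.transition, BlockRule.message, if_neg h, if_true]
      rfl
    have hidle : ∀ j ≠ R.select σ, respond (L j)
        ((s j, (x, as j)), (R.transition (σ, R.select σ, y)).2 j) = Measure.dirac (s j) := by
      intro j hj
      simp only [BlockRule.transition, BlockRule.message, if_neg h, if_neg hj]
      rfl
    have hfσ : Measurable fun s' => f (s', R.next (σ, y)) :=
      hf.comp (measurable_id.prodMk measurable_const)
    rw [if_neg h, pi_eq_map_update _ s (R.select σ) hidle, hplayed]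
    refine (integral_map (measurable_update s).aemeasurable hfσ.aestronglyMeasurable).trans ?_
    rfl

end AfterRound

section CorralBlockRule

variable {X : Type u} {A : Type v} [MeasurableSpace X] [MeasurableSpace A] {K : ℕ} {d : Fin K → ℕ}
  (P : Problem X A d) (L : Fin K → BaseLearner.{u, v, w} X A)
  {State : Type} [MeasurableSpace State] (R : BlockRule K State) (z : JointState L R.strategy)

lemma integral_corralPlay {f : (X × (Fin K → A)) × Fin K → ℝ} (hf : Measurable f) {B : ℝ}
    (hB : ∀ q, |f q| ≤ B) :
    ∫ q, f q ∂(corralPlay P L R.strategy z) =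
      ∫ q, f (q, R.select z.2) ∂(corralProposals P L R.strategy z) :=
  integral_compProd_dirac _ _ _ (fun _ => Kernel.deterministic_apply R.measurable_select _) hf hB

lemma integral_corralRound {f : ((X × (Fin K → A)) × Fin K) × ℝ → ℝ} (hf : Measurable f) {B : ℝ}
    (hB : ∀ q, |f q| ≤ B) :
    ∫ q, f q ∂(corralRound P L R.strategy z) =
      ∫ q, ∫ y, f ((q, R.select z.2), y) ∂(P.loss (R.select z.2, q.1, q.2 (R.select z.2)))
        ∂(corralProposals P L R.strategy z) := by
  have h : Measurable fun v : (X × (Fin K → A)) × Fin K =>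
      ∫ y, f (v, y) ∂(P.loss (v.2, v.1.1, v.1.2 v.2)) :=
    (hf.stronglyMeasurable.integral_kernel_prod_right'
      (κ := P.loss.comap _ measurable_played)).measurable
  exact (integral_compProd_of_abs_le _ _ _ hf hB).trans
    (integral_corralPlay P L R z h fun _ => abs_integral_le_of_abs_le fun _ => hB _)

lemma integral_corralMessages
    {f : (((X × (Fin K → A)) × Fin K) × ℝ) × (State × (Fin K → Message)) → ℝ}
    (hf : Measurable f) {B : ℝ} (hB : ∀ q, |f q| ≤ B) :
    ∫ q, f q ∂(corralMessages P L R.strategy z) =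
      ∫ q, ∫ y, f (((q, R.select z.2), y), R.transition (z.2, R.select z.2, y))
        ∂(P.loss (R.select z.2, q.1, q.2 (R.select z.2)))
        ∂(corralProposals P L R.strategy z) := by
  have hnext : Measurable fun q : ((X × (Fin K → A)) × Fin K) × ℝ =>
      (q, R.transition (z.2, q.1.2, q.2)) :=
    measurable_id.prodMk (R.measurable_transition.comp
      (measurable_const.prodMk (measurable_fst.snd.prodMk measurable_snd)))
  calc ∫ q, f q ∂(corralMessages P L R.strategy z)
      = ∫ q, f (q, R.transition (z.2, q.1.2, q.2)) ∂(corralRound P L R.strategy z) :=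
        integral_compProd_dirac _ _ _
          (fun _ => Kernel.deterministic_apply R.measurable_transition _) hf hB
    _ = _ := integral_corralRound P L R z (hf.comp hnext) fun _ => hB _

lemma corralRoundRegret_strategy : corralRoundRegret P L R.strategy z =
    roundRegret P (R.select z.2) (L (R.select z.2)) (z.1 (R.select z.2)) :=
  (integral_corralPlay P L R z (measurable_mean_played_sub_best P)
    fun _ => P.abs_mean_sub_best_le _ _ _).trans <|
  integral_corralProposals P L R.strategy z (R.select z.2)
    (measurable_mean_sub_best P (R.select z.2)) fun _ => P.abs_mean_sub_best_le _ _ _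

lemma integral_corralStep {f : JointState L R.strategy → ℝ} (hf : Measurable f) {B : ℝ}
    (hB : ∀ z, |f z| ≤ B) :
    ∫ z', f z' ∂(corralStep P L R.strategy z) =
      ∫ q, afterRound L R f z.1 z.2 q
        ∂(soloRound P (R.select z.2) (L (R.select z.2)) (z.1 (R.select z.2))) := by
  obtain ⟨s, σ⟩ := z
  have hA := measurable_afterRound (X := X) L R hf s σ
  have hAB := abs_afterRound_le (X := X) L R hB s σ
  have hloss : Measurable fun z : X × A =>
      ∫ y, afterRound L R f s σ (z, y) ∂(P.loss (R.select σ, z)) :=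
    (hA.stronglyMeasurable.integral_kernel_prod_right'
      (κ := P.loss.comap (fun z : X × A => (R.select σ, z)) (by fun_prop))).measurable
  have hpair : Measurable fun q : ((((X × (Fin K → A)) × Fin K) × ℝ) ×
      (R.strategy.State × (Fin K → Message))) × (∀ i, (L i).State) => f (q.2, q.1.2.1) :=
    hf.comp (by fun_prop)
  have hrespond : Measurable fun m : (((X × (Fin K → A)) × Fin K) × ℝ) ×
      (R.strategy.State × (Fin K → Message)) =>
      ∫ s', f (s', m.2.1) ∂(Measure.pi fun i => respond (L i)
        ((s i, (m.1.1.1.1, m.1.1.1.2 i)), m.2.2 i)) :=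
    (hpair.stronglyMeasurable.integral_kernel_prod_right'
      (κ := piKernel fun i => (respond (L i)).comap (fun m : (((X × (Fin K → A)) × Fin K) × ℝ) ×
        (R.strategy.State × (Fin K → Message)) => ((s i, (m.1.1.1.1, m.1.1.1.2 i)), m.2.2 i))
        (by fun_prop))).measurable
  unfold corralStep
  rw [Kernel.map_apply _ (by fun_prop), integral_map (by fun_prop) hf.aestronglyMeasurable]
  refine (integral_compProd_of_abs_le _ _ _ hpair fun _ => hB _).trans <|
    (integral_corralMessages P L R (s, σ) hrespond
      fun _ => abs_integral_le_of_abs_le fun _ => hB _).trans ?_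
  rw [integral_soloRound P _ _ _ (integrable_of_abs_le hA hAB),
    ← integral_corralProposals P L R.strategy (s, σ) (R.select σ) hloss
      fun _ => abs_integral_le_of_abs_le fun _ => hAB _]
  refine integral_congr_ae (.of_forall fun q => integral_congr_ae (.of_forall fun y => ?_))
  exact integral_respond L R hf s σ q.1 q.2 y

lemma corralRegretToGo_strategy_succ (r : ℕ) : corralRegretToGo P L R.strategy (r + 1) z =
    roundRegret P (R.select z.2) (L (R.select z.2)) (z.1 (R.select z.2)) +
      ∫ q, afterRound L R (corralRegretToGo P L R.strategy r) z.1 z.2 q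
        ∂(soloRound P (R.select z.2) (L (R.select z.2)) (z.1 (R.select z.2))) := by
  rw [← corralRoundRegret_strategy, ← integral_corralStep P L R z
    (measurable_corralRegretToGo P L R.strategy r) (abs_corralRegretToGo_le P L R.strategy r)]
  rfl

/-- The expected regret over `r` rounds of a block rule in the state `σ` when all learners start
anew. -/
def restartValue (r : ℕ) (σ : State) : ℝ :=
  ∫ s, corralRegretToGo P L R.strategy r (s, σ) ∂(initLaw L)

lemma restartValue_le (r : ℕ) (σ : State) : restartValue P L R r σ ≤ r :=
  (abs_le.1 (abs_integral_le_of_abs_le fun _ => abs_corralRegretToGo_le P L R.strategy r _)).2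

lemma restartValue_zero (σ : State) : restartValue P L R 0 σ = 0 := by
  simp [restartValue, corralRegretToGo, costToGo]

lemma corralRegret_strategy (T : ℕ) :
    corralRegret P L R.strategy T = restartValue P L R T R.start := by
  have hstart : corralLaw P L R.strategy 0 = (initLaw L).map fun s => (s, R.start) :=
    Measure.prod_dirac _
  rw [corralRegret_eq_integral_corralRegretToGo, hstart]
  exact integral_map (by fun_prop)
    (measurable_corralRegretToGo P L R.strategy T).aestronglyMeasurable

lemma restartValue_le_integral (r : ℕ) (σ : State) (i : Fin K) {g : (L i).State → ℝ}
    (hg : Integrable g (L i).init)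
    (h : ∀ s : ∀ i, (L i).State, corralRegretToGo P L R.strategy r (s, σ) ≤ g (s i)) :
    restartValue P L R r σ ≤ ∫ s, g s ∂(L i).init := by
  have hp := measurePreserving_eval (fun i => (L i).init) i
  rw [← hp.map_eq] at hg ⊢
  rw [integral_map hp.measurable.aemeasurable hg.1]
  exact integral_mono (integrable_of_abs_le
    ((measurable_corralRegretToGo P L R.strategy r).comp measurable_prodMk_right)
    fun _ => abs_corralRegretToGo_le P L R.strategy r _) (hg.comp_measurable hp.measurable) h

lemma integral_soloStep (i : Fin K) (s : (L i).State) {f : (L i).State → ℝ} (hf : Measurable f)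
    {B : ℝ} (hB : ∀ s, |f s| ≤ B) :
    ∫ s', f s' ∂(soloStep P i (L i) s) =
      ∫ z, ∫ s', f s' ∂((L i).update (s, z.1, z.2)) ∂(soloRound P i (L i) s) := by
  unfold soloStep
  rw [Kernel.snd_apply, integral_map (by fun_prop) hf.aestronglyMeasurable]
  exact integral_compProd_of_abs_le _ _ _ (hf.comp measurable_snd) fun _ => hB _

section OneRound

variable {r m : ℕ} {s : ∀ i, (L i).State} {σ : State} {i : Fin K} {a : ℝ} {h : ℝ → ℝ}

lemma afterRound_corralRegretToGo_le (hi : R.select σ = i)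
    (ha : ∀ s', 0 ≤ a * regretToGo P i (L i) m s')
    (hrestart : ∀ y, (σ, y) ∈ R.restarts → restartValue P L R r (R.next (σ, y)) ≤ h y)
    (hcont : ∀ y, (σ, y) ∉ R.restarts → ∀ s' : ∀ i, (L i).State,
      corralRegretToGo P L R.strategy r (s', R.next (σ, y)) ≤
        a * regretToGo P i (L i) m (s' i) + h y) (z : (X × A) × ℝ) :
    afterRound L R (corralRegretToGo P L R.strategy r) s σ z ≤
      a * ∫ s', regretToGo P i (L i) m s' ∂((L i).update (s i, z.1, z.2)) + h z.2 := by
  subst hi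
  rw [← integral_const_mul]
  unfold afterRound
  split_ifs with hz
  · exact (hrestart z.2 hz).trans (le_add_of_nonneg_left (integral_nonneg ha))
  · set i := R.select σ
    have hreg : Integrable (fun s' => a * regretToGo P i (L i) m s')
        ((L i).update (s i, z.1, z.2)) :=
      (integrable_of_abs_le (measurable_regretToGo P i (L i) m)
        (abs_regretToGo_le P i (L i) m)).const_mul a
    calc ∫ s', corralRegretToGo P L R.strategy r (Function.update s i s', R.next (σ, z.2))
          ∂((L i).update (s i, z.1, z.2))
        ≤ ∫ s', (a * regretToGo P i (L i) m s' + h z.2) ∂((L i).update (s i, z.1, z.2)) := by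
          refine integral_mono (integrable_of_abs_le ((measurable_corralRegretToGo P L _ r).comp
            ((measurable_update s).prodMk measurable_const))
            fun _ => abs_corralRegretToGo_le P L R.strategy r _)
            (hreg.add (integrable_const _)) fun s' => ?_
          simpa only [i, Function.update_self] using hcont z.2 hz (Function.update s i s')
      _ = _ := by
          rw [integral_add hreg (integrable_const _)]
          simp

lemma corralRegretToGo_succ_le (hi : R.select σ = i)
    (ha : ∀ s', 0 ≤ a * regretToGo P i (L i) m s')
    (hint : Integrable (fun z => h z.2) (soloRound P i (L i) (s i)))
    (hrestart : ∀ y, (σ, y) ∈ R.restarts → restartValue P L R r (R.next (σ, y)) ≤ h y)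
    (hcont : ∀ y, (σ, y) ∉ R.restarts → ∀ s' : ∀ i, (L i).State,
      corralRegretToGo P L R.strategy r (s', R.next (σ, y)) ≤
        a * regretToGo P i (L i) m (s' i) + h y) :
    corralRegretToGo P L R.strategy (r + 1) (s, σ) ≤ roundRegret P i (L i) (s i) +
      a * ∫ s', regretToGo P i (L i) m s' ∂(soloStep P i (L i) (s i)) +
      ∫ z, h z.2 ∂(soloRound P i (L i) (s i)) := by
  have hρ := measurable_regretToGo P i (L i) m
  have hρB := abs_regretToGo_le P i (L i) m
  have hu : Measurable fun z : (X × A) × ℝ => (s i, z.1, z.2) := by fun_prop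
  have hreg : Integrable (fun z : (X × A) × ℝ =>
      a * ∫ s', regretToGo P i (L i) m s' ∂((L i).update (s i, z.1, z.2)))
      (soloRound P i (L i) (s i)) :=
    (integrable_of_abs_le (measurable_integral_kernel ((L i).update.comap _ hu) hρ)
      fun _ => abs_integral_le_of_abs_le hρB).const_mul a
  have hafter : Integrable (afterRound L R (corralRegretToGo P L R.strategy r) s σ)
      (soloRound P i (L i) (s i)) :=
    integrable_of_abs_le (measurable_afterRound L R (measurable_corralRegretToGo P L _ r) s σ)
      (abs_afterRound_le L R (abs_corralRegretToGo_le P L R.strategy r) s σ)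
  have hle := integral_mono hafter (hreg.add hint)
    (afterRound_corralRegretToGo_le P L R hi ha hrestart hcont)
  rw [integral_add' hreg hint] at hle
  rw [corralRegretToGo_strategy_succ, integral_soloStep P L i _ hρ hρB, ← integral_const_mul,
    add_assoc]
  subst hi
  gcongr

end OneRound

end CorralBlockRule

/-! ### Exploring and committing -/

/-- The state of the explore-then-commit strategy: the current phase, the number of exploration
blocks that remain in it, the number of rounds and the sum of the losses in the current block, and
an upper confidence bound of the optimal value. -/
structure BlockState where
  phase : ℕ
  remaining : ℕ
  rounds : ℕ
  total : ℝ
  bound : ℝ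

namespace BlockState

instance : MeasurableSpace BlockState :=
  .comap (fun σ => (σ.phase, σ.remaining, σ.rounds, σ.total, σ.bound)) inferInstance

lemma measurable_coordinates : Measurable fun σ : BlockState =>
    (σ.phase, σ.remaining, σ.rounds, σ.total, σ.bound) :=
  comap_measurable _

@[fun_prop]
lemma measurable_phase : Measurable phase := measurable_coordinates.fst

@[fun_prop]
lemma measurable_remaining : Measurable remaining := measurable_coordinates.snd.fst

@[fun_prop]
lemma measurable_rounds : Measurable rounds := measurable_coordinates.snd.snd.fst

@[fun_prop]
lemma measurable_total : Measurable total := measurable_coordinates.snd.snd.snd.fst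

@[fun_prop]
lemma measurable_bound : Measurable bound := measurable_coordinates.snd.snd.snd.snd

@[fun_prop]
lemma measurable_mk {Z : Type*} [MeasurableSpace Z] {b q n : Z → ℕ} {S W : Z → ℝ}
    (hb : Measurable b) (hq : Measurable q) (hn : Measurable n) (hS : Measurable S)
    (hW : Measurable W) : Measurable fun z => mk (b z) (q z) (n z) (S z) (W z) :=
  measurable_comap_iff.2 (hb.prodMk (hq.prodMk (hn.prodMk (hS.prodMk hW))))

end BlockState

/-- The state at the start of a block in phase `b`, when `q` exploration blocks remain and the
optimal value is bounded by `W`. -/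
def blockStart (b q : ℕ) (W : ℝ) : BlockState := ⟨b, q, 0, 0, W⟩

/-- The parameters of the explore-then-commit strategy. There is an arm for each `j : ℕ`, which is
represented by the base learner `rep j`. In phase `b`, the strategy plays `copies` blocks of length
`len b j` of each arm `j = top, …, b + 1`, and then the arm `b`. It keeps an upper confidence bound
`W` of the optimal value, of width `conf / √N` after a block of length `N`; as soon as the losses of
an arm `j` in a block exceed the bound by `thr j`, the phase `j + 1` starts. The first phase is
`first`. -/
structure Config (K : ℕ) where
  copies : ℕ
  top : ℕ
  len : ℕ → ℕ → ℕ
  thr : ℕ → ℝ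
  conf : ℝ
  rep : ℕ → Fin K
  first : ℕ

namespace Config

variable {K : ℕ} (c : Config K)

/-- The arm that is played in phase `b` when `q` exploration blocks remain. -/
def arm (b q : ℕ) : ℕ := b + (q + c.copies - 1) / c.copies

lemma le_arm (b q : ℕ) : b ≤ c.arm b q := Nat.le_add_right _ _

lemma arm_zero (b : ℕ) (hc : 0 < c.copies) : c.arm b 0 = b := by
  simp only [arm, zero_add, Nat.add_eq_left]
  exact Nat.div_eq_of_lt (by omega)

lemma arm_le {b q k : ℕ} (hc : 0 < c.copies) (hq : q ≤ c.copies * k) : c.arm b q ≤ b + k := by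
  refine Nat.add_le_add_left (Nat.lt_succ_iff.1 ((Nat.div_lt_iff_lt_mul hc).2 ?_)) b
  rw [Nat.succ_mul, mul_comm k]
  omega

lemma lt_arm {b q k : ℕ} (hc : 0 < c.copies) (hq : c.copies * k < q) : b + k < c.arm b q := by
  refine Nat.add_lt_add_left (Nat.lt_of_succ_le ((Nat.le_div_iff_mul_le hc).2 ?_)) b
  rw [Nat.succ_mul, mul_comm k]
  omega

/-- The arm that is played in the state `σ`. -/
def currentArm (σ : BlockState) : ℕ := c.arm σ.phase σ.remaining

/-- The length of the block to which the state `σ` belongs. -/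
def currentLen (σ : BlockState) : ℕ := c.len σ.phase (c.currentArm σ)

/-- The state at the start of phase `b`; the initial bound is `1` because the losses lie in
`[0, 1]`. -/
def phaseStart (b : ℕ) : BlockState := blockStart b (c.copies * (c.top - b)) 1

/-- The bound of the optimal value after a block of length `N` with total loss `S`. -/
def newBound (N : ℕ) (S W : ℝ) : ℝ := min W (S / N + c.conf / √N)

lemma newBound_le (N : ℕ) (S W : ℝ) : c.newBound N S W ≤ W := min_le_left _ _

lemma le_newBound {N : ℕ} {S W v : ℝ} (hN : 1 ≤ N) (hW : v ≤ W)
    (hS : -(c.conf * √N) ≤ S - N * v) : v ≤ c.newBound N S W := by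
  have hN' : (0 : ℝ) < N := by exact_mod_cast hN
  have hwidth : c.conf / √N = c.conf * √N / N := by
    rw [div_eq_div_iff (by positivity) (by positivity), mul_assoc, Real.mul_self_sqrt hN'.le]
  refine le_min hW ?_
  rw [hwidth, ← add_div, le_div_iff₀ hN']
  linarith

lemma newBound_le_add {N : ℕ} {S W v x : ℝ} (hN : 1 ≤ N) (hS : S - N * v ≤ x * √N) :
    c.newBound N S W ≤ v + (x + c.conf) / √N := by
  have hN' : (0 : ℝ) < N := by exact_mod_cast hN
  have hwidth : x / √N = x * √N / N := by
    rw [div_eq_div_iff (by positivity) (by positivity), mul_assoc, Real.mul_self_sqrt hN'.le]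
  refine (min_le_right _ _).trans ?_
  rw [add_div, hwidth, ← add_assoc]
  gcongr
  rw [div_le_iff₀ hN', add_mul, div_mul_cancel₀ _ hN'.ne']
  linarith

/-- The pairs of a state and a loss for which the losses in the block become too large. -/
def exceeds : Set (BlockState × ℝ) :=
  {p | c.thr (c.currentArm p.1) < p.1.total + p.2 - ((p.1.rounds + 1 : ℕ) : ℝ) * p.1.bound}

/-- The pairs of a state and a loss for which the block ends because it has full length. -/
def completes : Set (BlockState × ℝ) :=
  {p | p.1.rounds + 1 = c.currentLen p.1}

open Classical in
/-- The state after a round in the state `p.1` with the loss `p.2`. -/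
def next (p : BlockState × ℝ) : BlockState :=
  if p ∈ c.exceeds then c.phaseStart (c.currentArm p.1 + 1)
  else if p ∈ c.completes then
    blockStart p.1.phase (p.1.remaining - 1)
      (c.newBound (c.currentLen p.1) (p.1.total + p.2) p.1.bound)
  else ⟨p.1.phase, p.1.remaining, p.1.rounds + 1, p.1.total + p.2, p.1.bound⟩

@[fun_prop]
lemma measurable_currentArm : Measurable c.currentArm :=
  (Measurable.of_discrete (f := fun q : ℕ × ℕ => c.arm q.1 q.2)).comp
    (BlockState.measurable_phase.prodMk BlockState.measurable_remaining)

@[fun_prop]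
lemma measurable_currentLen : Measurable c.currentLen :=
  (Measurable.of_discrete (f := fun q : ℕ × ℕ => c.len q.1 q.2)).comp
    (BlockState.measurable_phase.prodMk c.measurable_currentArm)

lemma measurableSet_exceeds : MeasurableSet c.exceeds := by
  have hthr : Measurable fun p : BlockState × ℝ => c.thr (c.currentArm p.1) :=
    (Measurable.of_discrete (f := c.thr)).comp (by fun_prop)
  have hrounds : Measurable fun p : BlockState × ℝ => ((p.1.rounds + 1 : ℕ) : ℝ) :=
    (Measurable.of_discrete (f := fun n : ℕ => ((n + 1 : ℕ) : ℝ))).comp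
      (BlockState.measurable_rounds.comp measurable_fst)
  exact measurableSet_lt hthr (by fun_prop)

lemma measurableSet_completes : MeasurableSet c.completes :=
  measurableSet_eq_fun (by fun_prop) (by fun_prop)

lemma measurable_next : Measurable c.next := by
  classical
  refine Measurable.ite c.measurableSet_exceeds ?_ (Measurable.ite c.measurableSet_completes ?_ ?_)
  · exact (Measurable.of_discrete (f := fun j : ℕ => c.phaseStart (j + 1))).comp (by fun_prop)
  · have : Measurable fun p : BlockState × ℝ => (c.currentLen p.1 : ℝ) :=
      (Measurable.of_discrete (f := fun n : ℕ => (n : ℝ))).comp (by fun_prop)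
    have : Measurable fun p : BlockState × ℝ => p.1.remaining - 1 :=
      (Measurable.of_discrete (f := fun n : ℕ => n - 1)).comp (by fun_prop)
    unfold blockStart newBound
    fun_prop
  · fun_prop

/-- The explore-then-commit strategy as a block rule. -/
def rule : BlockRule K BlockState where
  start := c.phaseStart c.first
  select σ := c.rep (c.currentArm σ)
  measurable_select := (Measurable.of_discrete (f := c.rep)).comp c.measurable_currentArm
  next := c.next
  measurable_next := c.measurable_next
  restarts := c.exceeds ∪ c.completes
  measurableSet_restarts := c.measurableSet_exceeds.union c.measurableSet_completes

variable {c} {b q n : ℕ} {S W y : ℝ}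

lemma mem_exceeds_iff : ((⟨b, q, n, S, W⟩ : BlockState), y) ∈ c.exceeds ↔
    c.thr (c.arm b q) + (n + 1) * W < S + y := by
  simp only [exceeds, Set.mem_ofPred_eq, currentArm, lt_sub_iff_add_lt, Nat.cast_add, Nat.cast_one]

lemma mem_completes_iff : ((⟨b, q, n, S, W⟩ : BlockState), y) ∈ c.completes ↔
    n + 1 = c.len b (c.arm b q) :=
  Iff.rfl

lemma rule_next_of_exceeds (h : c.thr (c.arm b q) + (n + 1) * W < S + y) :
    c.rule.next (⟨b, q, n, S, W⟩, y) = c.phaseStart (c.arm b q + 1) :=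
  if_pos (mem_exceeds_iff.2 h)

lemma rule_next_of_completes (h : ¬ c.thr (c.arm b q) + (n + 1) * W < S + y)
    (hn : n + 1 = c.len b (c.arm b q)) : c.rule.next (⟨b, q, n, S, W⟩, y) =
      blockStart b (q - 1) (c.newBound (c.len b (c.arm b q)) (S + y) W) :=
  (if_neg (mem_exceeds_iff.not.2 h)).trans (if_pos (mem_completes_iff.2 hn))

lemma rule_next_of_continues (h : ¬ c.thr (c.arm b q) + (n + 1) * W < S + y)
    (hn : n + 1 ≠ c.len b (c.arm b q)) :
    c.rule.next (⟨b, q, n, S, W⟩, y) = ⟨b, q, n + 1, S + y, W⟩ :=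
  (if_neg (mem_exceeds_iff.not.2 h)).trans (if_neg (mem_completes_iff.not.2 hn))

lemma mem_restarts_iff : ((⟨b, q, n, S, W⟩ : BlockState), y) ∈ c.rule.restarts ↔
    c.thr (c.arm b q) + (n + 1) * W < S + y ∨ n + 1 = c.len b (c.arm b q) :=
  or_congr mem_exceeds_iff mem_completes_iff

end Config

/-! ### The regret of a block -/

section Blocks

variable {X : Type u} {A : Type v} [MeasurableSpace X] [MeasurableSpace A] {K : ℕ} {d : Fin K → ℕ}
  (P : Problem X A d) (L : Fin K → BaseLearner.{u, v, w} X A) (c : Config K)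

/-- Potentials that bound the regret over `r₀` rounds from the start of a block of `N` rounds of the
arm `j`: `g n S` after `n` rounds with total loss `S`, and `h n S y` after one more round with loss
`y`, both up to the multiple `a` of the regret of the learner in the rest of the block. Only pairs
`(n, S)` for which the losses have not exceeded the bound are considered. -/
structure IsBlockPotential (b q j N r₀ : ℕ) (W a : ℝ) (g : ℕ → ℝ → ℝ) (h : ℕ → ℝ → ℝ → ℝ) :
    Prop where
  nonneg : ∀ n S, n ≤ N → S ≤ c.thr j + n * W → 0 ≤ g n S
  integrable : ∀ n S s,
    Integrable (fun z => h n S z.2) (soloRound P (c.rep j) (L (c.rep j)) s)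
  step : ∀ n S s, roundRegret P (c.rep j) (L (c.rep j)) s +
    ∫ z, h n S z.2 ∂(soloRound P (c.rep j) (L (c.rep j)) s) ≤
      a * roundRegret P (c.rep j) (L (c.rep j)) s + g n S
  of_exceeds : ∀ n r S y, n < N → r < r₀ → S ≤ c.thr j + n * W →
    c.thr j + (n + 1) * W < S + y → restartValue P L c.rule r (c.phaseStart (j + 1)) ≤ h n S y
  of_completes : ∀ n r S y, n + 1 = N → r + N = r₀ → S ≤ c.thr j + n * W →
    restartValue P L c.rule r (blockStart b (q - 1) (c.newBound N (S + y) W)) ≤ h n S y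
  of_continues : ∀ n S y, n < N → g (n + 1) (S + y) ≤ h n S y

variable {P L c} {b q j N r₀ : ℕ} {W a : ℝ} {g : ℕ → ℝ → ℝ} {h : ℕ → ℝ → ℝ → ℝ}

lemma IsBlockPotential.corralRegretToGo_le (hp : IsBlockPotential P L c b q j N r₀ W a g h)
    (hj : c.arm b q = j) (hN : c.len b j = N)
    (ha : ∀ m s, 0 ≤ a * regretToGo P (c.rep j) (L (c.rep j)) m s) {m n r : ℕ} {S : ℝ}
    (hm : 1 ≤ m) (hmn : n + m = N) (hr : r + n = r₀) (hS : S ≤ c.thr j + n * W)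
    (s : ∀ i, (L i).State) :
    corralRegretToGo P L c.rule.strategy r (s, ⟨b, q, n, S, W⟩) ≤
      a * regretToGo P (c.rep j) (L (c.rep j)) m (s (c.rep j)) + g n S := by
  subst hj
  subst hN
  induction m generalizing n r S s with
  | zero => omega
  | succ m ih =>
    rcases r with _ | r
    · exact add_nonneg (ha _ _) (hp.nonneg n S (by omega) hS)
    have hround := corralRegretToGo_succ_le P L c.rule (i := c.rep (c.arm b q)) (h := h n S)
      (r := r) (σ := ⟨b, q, n, S, W⟩) rfl (ha m) (hp.integrable n S (s (c.rep (c.arm b q))))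
      (fun y hy => by
        by_cases hex : c.thr (c.arm b q) + (n + 1) * W < S + y
        · rw [Config.rule_next_of_exceeds hex]
          exact hp.of_exceeds n r S y (by omega) (by omega) hS hex
        · have hcomp := (Config.mem_restarts_iff.1 hy).resolve_left hex
          rw [Config.rule_next_of_completes hex hcomp]
          exact hp.of_completes n r S y hcomp (by omega) hS)
      (fun y hy s' => by
        obtain ⟨hex, hcomp⟩ := not_or.1 (Config.mem_restarts_iff.not.1 hy)
        rw [Config.rule_next_of_continues hex hcomp]
        refine (ih (by omega) (by omega) s' ?_ (by omega)).trans ?_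
        · push_cast
          exact not_lt.1 hex
        · gcongr
          exact hp.of_continues n S y (by omega))
    rw [regretToGo, costToGo, mul_add]
    have hstep := hp.step n S (s (c.rep (c.arm b q)))
    unfold regretToGo at hround
    linarith

lemma IsBlockPotential.restartValue_le (hp : IsBlockPotential P L c b q j N r₀ W a g h)
    (hj : c.arm b q = j) (hN : c.len b j = N)
    (ha : ∀ m s, 0 ≤ a * regretToGo P (c.rep j) (L (c.rep j)) m s) (hN1 : 1 ≤ N)
    (hthr : 0 ≤ c.thr j) :
    restartValue P L c.rule r₀ (blockStart b q W) ≤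
      a * soloRegret P (c.rep j) (L (c.rep j)) N + g 0 0 := by
  have hint : Integrable (fun s => a * regretToGo P (c.rep j) (L (c.rep j)) N s)
      (L (c.rep j)).init :=
    (integrable_of_abs_le (measurable_regretToGo P _ (L (c.rep j)) N)
      (abs_regretToGo_le P _ (L (c.rep j)) N)).const_mul a
  refine (restartValue_le_integral P L c.rule r₀ _ (c.rep j) (hint.add (integrable_const (g 0 0)))
    fun s => hp.corralRegretToGo_le hj hN ha hN1 (by omega) rfl (by simpa using hthr) s).trans ?_
  rw [soloRegret_eq_integral_regretToGo, ← integral_const_mul]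
  simp only [Pi.add_apply]
  rw [integral_add hint (integrable_const _)]
  simp

/-- The exponential of the total excess loss `x`, compensated for `m` remaining rounds; in a block
of a well-specified learner it is a supermartingale. -/
def expPotential (t m x : ℝ) : ℝ := Real.exp (-t * x + t ^ 2 * m)

/-- A smooth upper bound of the positive part of the total excess loss `x`, when `m` rounds
remain. -/
def posPartPotential (t m x : ℝ) : ℝ := x + expPotential t m x / t

lemma expPotential_nonneg (t m x : ℝ) : 0 ≤ expPotential t m x := (Real.exp_pos _).le

lemma expPotential_add (t m x y : ℝ) :
    expPotential t m (x + y) = expPotential t m x * Real.exp (-t * y) := by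
  simp only [expPotential, ← Real.exp_add]
  ring_nf

lemma expPotential_add_one (t m x : ℝ) :
    expPotential t (m + 1) x = expPotential t m x * Real.exp (t ^ 2) := by
  simp only [expPotential, ← Real.exp_add]
  ring_nf

lemma le_posPartPotential {t : ℝ} (ht : 0 < t) (m x : ℝ) : x ≤ posPartPotential t m x :=
  le_add_of_nonneg_right (div_nonneg (expPotential_nonneg t m x) ht.le)

lemma posPartPotential_nonneg {t m : ℝ} (ht : 0 < t) (hm : 0 ≤ m) (x : ℝ) :
    0 ≤ posPartPotential t m x := by
  have hexp : -(t * x) ≤ expPotential t m x := by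
    have := Real.add_one_le_exp (-t * x + t ^ 2 * m)
    have : 0 ≤ t ^ 2 * m := by positivity
    unfold expPotential
    linarith
  have : -x ≤ expPotential t m x / t := by
    rw [le_div_iff₀ ht]
    linarith
  unfold posPartPotential
  linarith

section WellSpecified

variable {i : Fin K} {B : BaseLearner.{u, v, w} X A} {t : ℝ} (hi : P.iStar ≤ i)
include hi

lemma integrable_expPotential (ht : 0 ≤ t) (m x : ℝ) (s : B.State) :
    Integrable (fun z => expPotential t m (x + (z.2 - P.value))) (soloRound P i B s) := by
  simp only [expPotential_add]
  exact (integrable_exp_neg_soloRound P B s hi ht).const_mul _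

lemma integral_expPotential_le (ht : 0 ≤ t) (m x : ℝ) (s : B.State) :
    ∫ z, expPotential t m (x + (z.2 - P.value)) ∂(soloRound P i B s) ≤
      expPotential t (m + 1) x := by
  simp only [expPotential_add, expPotential_add_one, integral_const_mul]
  exact mul_le_mul_of_nonneg_left (integral_exp_neg_soloRound_le P B s hi ht)
    (expPotential_nonneg t m x)

lemma integrable_posPartPotential (ht : 0 ≤ t) (m x : ℝ) (s : B.State) :
    Integrable (fun z => posPartPotential t m (x + (z.2 - P.value))) (soloRound P i B s) :=
  ((integrable_const x).add (integrable_sub_value_soloRound P i B s)).add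
    ((integrable_expPotential hi ht m x s).div_const t)

lemma integral_posPartPotential_le (ht : 0 ≤ t) (m x : ℝ) (s : B.State) :
    ∫ z, posPartPotential t m (x + (z.2 - P.value)) ∂(soloRound P i B s) ≤
      posPartPotential t (m + 1) x + roundRegret P i B s := by
  have hlin : Integrable (fun z => x + (z.2 - P.value)) (soloRound P i B s) :=
    (integrable_const x).add (integrable_sub_value_soloRound P i B s)
  have hexp := div_le_div_of_nonneg_right (integral_expPotential_le hi ht m x s) ht
  simp only [posPartPotential]
  rw [integral_add hlin ((integrable_expPotential hi ht m x s).div_const t), integral_div,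
    integral_add (integrable_const x) (integrable_sub_value_soloRound P i B s),
    integral_sub_value_soloRound]
  simp only [integral_const, probReal_univ, smul_eq_mul, one_mul]
  linarith

end WellSpecified

/-- The potential of a block of `N` rounds of a well-specified learner, after `n` rounds with total
loss `S`: `x = S - n v` is the excess over the optimal value `v`, the second term pays for large and
the third term for small losses. -/
def wellSpecifiedPotential (c₀ a c₃ t l w v : ℝ) (N n : ℕ) (S : ℝ) : ℝ :=
  c₀ + a * posPartPotential t (N - n) (S - n * v) +
    c₃ * Real.exp (-l * w) * expPotential l (N - n) (S - n * v)

section WellSpecifiedBlock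

variable {E c₀ c₁ c₂ c₃ t l : ℝ}

/-- The excess of the losses over the optimal value is at least `thr j` when the next phase starts,
and so it pays for the regret `c₁` of that phase. -/
lemma le_wellSpecifiedPotential_of_exceeds {w v : ℝ} {n : ℕ} {S : ℝ} (hthr : 0 < c.thr j)
    (hc₀ : 0 ≤ c₀) (hc₁ : 0 ≤ c₁) (hc₃ : 0 ≤ c₃) (ha : c₁ / c.thr j ≤ a) (ht : 0 < t)
    (hS : c.thr j ≤ S - n * v) : c₁ ≤ wellSpecifiedPotential c₀ a c₃ t l w v N n S := by
  have hpos : c₁ ≤ a * posPartPotential t (N - n) (S - n * v) := calc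
    c₁ = c₁ / c.thr j * c.thr j := (div_mul_cancel₀ c₁ hthr.ne').symm
    _ ≤ a * posPartPotential t (N - n) (S - n * v) :=
      mul_le_mul ha (hS.trans (le_posPartPotential ht _ _)) hthr.le
        ((div_nonneg hc₁ hthr.le).trans ha)
  have hexp : 0 ≤ c₃ * Real.exp (-l * w) * expPotential l (N - n) (S - n * v) :=
    mul_nonneg (by positivity) (expPotential_nonneg _ _ _)
  unfold wellSpecifiedPotential
  linarith

lemma le_wellSpecifiedPotential_of_completes {w v S : ℝ} (hE : 0 < E) (hc₂ : 0 ≤ c₂)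
    (hc₃ : 0 ≤ c₃) (ha : c₂ / (2 * E) ≤ a) (ht : 0 < t) (hl : 0 ≤ l) :
    c₀ + (if 2 * E < S - N * v then c₂ else 0) + (if S - N * v < -w then c₃ else 0) ≤
      wellSpecifiedPotential c₀ a c₃ t l w v N N S := by
  have ha' : 0 ≤ a := (div_nonneg hc₂ (by positivity)).trans ha
  unfold wellSpecifiedPotential
  rw [sub_self]
  gcongr
  · split_ifs with hlarge
    · calc c₂ = c₂ / (2 * E) * (2 * E) := (div_mul_cancel₀ c₂ (by positivity)).symm
        _ ≤ a * posPartPotential t 0 (S - N * v) := by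
          gcongr
          exact hlarge.le.trans (le_posPartPotential ht _ _)
    · exact mul_nonneg ha' (posPartPotential_nonneg ht le_rfl _)
  · split_ifs with hsmall
    · rw [mul_assoc, expPotential, ← Real.exp_add]
      exact le_mul_of_one_le_right hc₃ (Real.one_le_exp (by nlinarith))
    · exact mul_nonneg (by positivity) (expPotential_nonneg _ _ _)

lemma wellSpecifiedPotential_succ (a w v y S : ℝ) (n : ℕ) :
    wellSpecifiedPotential c₀ a c₃ t l w v N (n + 1) (S + y) =
      c₀ + a * posPartPotential t (N - n - 1) (S - n * v + (y - v)) +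
        c₃ * Real.exp (-l * w) * expPotential l (N - n - 1) (S - n * v + (y - v)) := by
  have hx : S + y - ((n + 1 : ℕ) : ℝ) * v = S - n * v + (y - v) := by push_cast; ring
  have hm : (N : ℝ) - ((n + 1 : ℕ) : ℝ) = N - n - 1 := by push_cast; ring
  rw [wellSpecifiedPotential, hx, hm]

variable (hi : P.iStar ≤ c.rep j)
include hi

lemma integrable_wellSpecifiedPotential (ht : 0 ≤ t) (hl : 0 ≤ l) (a w S : ℝ) (n : ℕ)
    (s : (L (c.rep j)).State) :
    Integrable (fun z => wellSpecifiedPotential c₀ a c₃ t l w P.value N (n + 1) (S + z.2))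
      (soloRound P (c.rep j) (L (c.rep j)) s) := by
  simp only [wellSpecifiedPotential_succ]
  exact ((integrable_const _).add ((integrable_posPartPotential hi ht _ _ s).const_mul _)).add
    ((integrable_expPotential hi hl _ _ s).const_mul _)

lemma integral_wellSpecifiedPotential_le (ha : 0 ≤ a) (hc₃ : 0 ≤ c₃) (ht : 0 ≤ t) (hl : 0 ≤ l)
    (w S : ℝ) (n : ℕ) (s : (L (c.rep j)).State) :
    ∫ z, wellSpecifiedPotential c₀ a c₃ t l w P.value N (n + 1) (S + z.2)
        ∂(soloRound P (c.rep j) (L (c.rep j)) s) ≤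
      a * roundRegret P (c.rep j) (L (c.rep j)) s +
        wellSpecifiedPotential c₀ a c₃ t l w P.value N n S := by
  set x := S - n * P.value with hx
  set m : ℝ := N - n - 1 with hm
  have hpos := (integrable_posPartPotential hi ht m x s).const_mul a
  have hexp := (integrable_expPotential hi hl m x s).const_mul (c₃ * Real.exp (-l * w))
  have hconst : Integrable (fun z => c₀ + a * posPartPotential t m (x + (z.2 - P.value)))
    (soloRound P (c.rep j) (L (c.rep j)) s) := (integrable_const c₀).add hpos
  have hpos_le := mul_le_mul_of_nonneg_left (integral_posPartPotential_le hi ht m x s) ha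
  have hexp_le := mul_le_mul_of_nonneg_left (integral_expPotential_le hi hl m x s)
    (show 0 ≤ c₃ * Real.exp (-l * w) by positivity)
  simp only [wellSpecifiedPotential_succ, ← hx, ← hm]
  rw [integral_add hconst hexp, integral_add (integrable_const c₀) hpos, integral_const_mul,
    integral_const_mul, wellSpecifiedPotential, ← hx, show (N : ℝ) - n = m + 1 by rw [hm]; ring]
  simp only [integral_const, probReal_univ, smul_eq_mul, one_mul]
  linarith

lemma restartValue_le_of_wellSpecified (hj : c.arm b q = j) (hN : c.len b j = N) (hN1 : 1 ≤ N)
    (hW : P.value ≤ W) (hthr : 0 < c.thr j) (hE : 0 < E) (hc₀ : 0 ≤ c₀) (hc₁ : 0 ≤ c₁)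
    (hc₂ : 0 ≤ c₂) (hc₃ : 0 ≤ c₃) (ht : 0 < t) (hl : 0 ≤ l)
    (hexc : ∀ r ≤ r₀, restartValue P L c.rule r (c.phaseStart (j + 1)) ≤ c₁)
    (hcomp : ∀ r S, r + N = r₀ →
      restartValue P L c.rule r (blockStart b (q - 1) (c.newBound N S W)) ≤
        c₀ + (if 2 * E < S - N * P.value then c₂ else 0) +
          (if S - N * P.value < -(c.conf * √N) then c₃ else 0)) :
    restartValue P L c.rule r₀ (blockStart b q W) ≤
      (1 + (c₁ / c.thr j + c₂ / (2 * E))) * soloRegret P (c.rep j) (L (c.rep j)) N +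
        wellSpecifiedPotential c₀ (c₁ / c.thr j + c₂ / (2 * E)) c₃ t l (c.conf * √N) P.value
          N 0 0 := by
  set a := c₁ / c.thr j + c₂ / (2 * E)
  set g := wellSpecifiedPotential c₀ a c₃ t l (c.conf * √N) P.value N with hg
  have hac₁ : c₁ / c.thr j ≤ a := le_add_of_nonneg_right (by positivity)
  have hac₂ : c₂ / (2 * E) ≤ a := le_add_of_nonneg_left (by positivity)
  have ha : 0 ≤ a := by positivity
  refine IsBlockPotential.restartValue_le (h := fun n S y => g (n + 1) (S + y))
    ⟨?_, ?_, ?_, ?_, ?_, ?_⟩ hj hN (fun m s => ?_) hN1 hthr.le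
  · intro n S hn _
    have hm : (0 : ℝ) ≤ N - n := sub_nonneg.2 (by exact_mod_cast hn)
    exact add_nonneg (add_nonneg hc₀ (mul_nonneg ha (posPartPotential_nonneg ht hm _)))
      (mul_nonneg (by positivity) (expPotential_nonneg _ _ _))
  · exact fun n S s => integrable_wellSpecifiedPotential hi ht.le hl _ _ S n s
  · intro n S s
    linarith [integral_wellSpecifiedPotential_le (c₀ := c₀) (N := N) hi ha hc₃ ht.le hl
      (c.conf * √N) S n s]
  · intro n r S y _ hr _ hex
    refine (hexc r hr.le).trans
      (le_wellSpecifiedPotential_of_exceeds hthr hc₀ hc₁ hc₃ hac₁ ht ?_)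
    have : ((n + 1 : ℕ) : ℝ) * P.value ≤ ((n + 1 : ℕ) : ℝ) * W := by gcongr
    push_cast at this ⊢
    linarith
  · intro n r S y hn hr _
    simp only [hg, hn]
    exact (hcomp r (S + y) hr).trans
      (le_wellSpecifiedPotential_of_completes hE hc₂ hc₃ hac₂ ht hl)
  · exact fun _ _ _ _ => le_rfl
  · exact mul_nonneg (by positivity) (regretToGo_nonneg P _ _ hi m s)

end WellSpecifiedBlock

/-- The potential of a block of `N` rounds of an arbitrary learner, after `n` rounds with total loss
`S`, if the bound is at most `v`: the excess of `S` over `n v` is at most `thr` before the last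
loss, and the terms with `κ` control the last loss. -/
def accuratePotential (a e κ thr c₀ v : ℝ) (N n : ℕ) (S : ℝ) : ℝ :=
  a * (thr - (S - n * v)) + a * κ + 20 * a / κ * (N - n) + e * (N - n) + c₀

lemma accuratePotential_succ (a e κ thr c₀ v y S : ℝ) (N n : ℕ) :
    accuratePotential a e κ thr c₀ v N (n + 1) (S + y) =
      accuratePotential a e κ thr c₀ v N n S - 20 * a / κ - e - a * (y - v) := by
  unfold accuratePotential
  push_cast
  ring

section Accurate

variable {ε e κ c₀ : ℝ}

lemma le_accuratePotential {thr v x S : ℝ} {n : ℕ} (ha : 0 ≤ a) (he : 0 ≤ e) (hκ : 0 < κ)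
    (hn : n ≤ N) (hS : S - n * v ≤ thr + x) :
    a * (κ - x) + c₀ ≤ accuratePotential a e κ thr c₀ v N n S := by
  have hm : (0 : ℝ) ≤ N - n := sub_nonneg.2 (by exact_mod_cast hn)
  have hx : a * -x ≤ a * (thr - (S - n * v)) := by
    gcongr
    linarith
  have : 0 ≤ 20 * a / κ * (N - n) + e * (N - n) := by positivity
  unfold accuratePotential
  linarith

lemma le_accuratePotential_succ_add_sq {thr v S : ℝ} {n : ℕ} (ha : 0 ≤ a) (he : 0 ≤ e)
    (hκ : 0 < κ) (hε : 0 ≤ ε) (hW : W ≤ v + ε) (hn : n < N) (hS : S ≤ thr + n * W) (y : ℝ) :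
    c₀ ≤ accuratePotential a e κ thr c₀ (v + ε) N (n + 1) (S + y) + a / κ * (y - v) ^ 2 := by
  have hsq : 0 ≤ a * (κ + (y - v) ^ 2 / κ - (y - v)) := by
    have : κ + (y - v) ^ 2 / κ - (y - v) =
        ((κ - (y - v)) ^ 2 + κ ^ 2 + (y - v) ^ 2) / (2 * κ) := by
      field_simp
      ring
    rw [this]
    positivity
  have hexcess : S + y - ((n + 1 : ℕ) : ℝ) * (v + ε) ≤ thr + (y - (v + ε)) := by
    have : (n : ℝ) * W ≤ n * (v + ε) := by gcongr
    push_cast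
    linarith
  have := le_accuratePotential (c₀ := c₀) ha he hκ hn hexcess
  have : 0 ≤ a * ε := mul_nonneg ha hε
  linarith [show a / κ * (y - v) ^ 2 = a * ((y - v) ^ 2 / κ) by ring]

lemma integrable_accuratePotential (i : Fin K) (B : BaseLearner.{u, v, w} X A) (s : B.State)
    (a e κ thr c₀ v a' S : ℝ) (N n : ℕ) :
    Integrable (fun z => accuratePotential a e κ thr c₀ v N (n + 1) (S + z.2) +
      a' * (z.2 - P.value) ^ 2) (soloRound P i B s) := by
  have hloss : Integrable (fun z => z.2 - v) (soloRound P i B s) := by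
    simpa only [Pi.add_def, sub_add_sub_cancel] using
      (integrable_sub_value_soloRound P i B s).add (integrable_const (P.value - v))
  simp only [accuratePotential_succ]
  exact ((integrable_const _).sub (hloss.const_mul a)).add
    ((integrable_sq_soloRound P i B s).const_mul a')

lemma integral_accuratePotential_le (i : Fin K) (B : BaseLearner.{u, v, w} X A) (s : B.State)
    (ha : 0 ≤ a) (hκ : 0 < κ) (thr S : ℝ) (n : ℕ) :
    ∫ z, (accuratePotential a e κ thr c₀ (P.value + ε) N (n + 1) (S + z.2) +
        a / κ * (z.2 - P.value) ^ 2) ∂(soloRound P i B s) ≤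
      accuratePotential a e κ thr c₀ (P.value + ε) N n S -
        (a * (roundRegret P i B s - ε) + e) := by
  have hlin := (integrable_sub_value_soloRound P i B s).const_mul a
  have hsq := (integrable_sq_soloRound P i B s).const_mul (a / κ)
  have hsq_le := mul_le_mul_of_nonneg_left (integral_sq_soloRound_le P i B s)
    (show 0 ≤ a / κ by positivity)
  set g := accuratePotential a e κ thr c₀ (P.value + ε) N n S with hg
  have hsub : Integrable (fun z => g - 20 * a / κ - e + a * ε - a * (z.2 - P.value))
    (soloRound P i B s) := (integrable_const _).sub hlin
  calc ∫ z, (accuratePotential a e κ thr c₀ (P.value + ε) N (n + 1) (S + z.2) +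
        a / κ * (z.2 - P.value) ^ 2) ∂(soloRound P i B s)
      = ∫ z, (g - 20 * a / κ - e + a * ε - a * (z.2 - P.value) +
          a / κ * (z.2 - P.value) ^ 2) ∂(soloRound P i B s) := by
        refine integral_congr_ae (.of_forall fun z => ?_)
        simp only [accuratePotential_succ, ← hg]
        ring
    _ = g - 20 * a / κ - e + a * ε - a * roundRegret P i B s +
          a / κ * ∫ z, (z.2 - P.value) ^ 2 ∂(soloRound P i B s) := by
        rw [integral_add hsub hsq, integral_sub (integrable_const _) hlin, integral_const_mul,
          integral_const_mul, integral_sub_value_soloRound]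
        simp
    _ ≤ g - (a * (roundRegret P i B s - ε) + e) := by
        linarith [show 20 * a / κ = a / κ * 20 by ring]

lemma restartValue_le_of_accurate (hj : c.arm b q = j) (hN : c.len b j = N) (hN1 : 1 ≤ N)
    (hthr : 0 ≤ c.thr j) (hε : 0 ≤ ε) (hW : W ≤ P.value + ε) (ha : 0 ≤ a) (he : 0 ≤ e)
    (hκ : 0 < κ) (hc₀ : 0 ≤ c₀)
    (hdrift : ∀ s, roundRegret P (c.rep j) (L (c.rep j)) s ≤
      a * (roundRegret P (c.rep j) (L (c.rep j)) s - ε) + e)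
    (hexc : ∀ r ≤ r₀, restartValue P L c.rule r (c.phaseStart (j + 1)) ≤ c₀)
    (hcomp : ∀ r S, r + N = r₀ →
      restartValue P L c.rule r (blockStart b (q - 1) (c.newBound N S W)) ≤ c₀) :
    restartValue P L c.rule r₀ (blockStart b q W) ≤
      a * c.thr j + a * κ + 20 * a / κ * N + e * N + c₀ := by
  set g := accuratePotential a e κ (c.thr j) c₀ (P.value + ε) N with hg
  have hp : IsBlockPotential P L c b q j N r₀ W 0 g
      fun n S y => g (n + 1) (S + y) + a / κ * (y - P.value) ^ 2 := by
    refine ⟨fun n S hn hS => ?_, fun n S s => ?_, fun n S s => ?_, ?_, ?_, ?_⟩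
    · have hx : S - n * (P.value + ε) ≤ c.thr j + 0 := by
        have : (n : ℝ) * W ≤ n * (P.value + ε) := by gcongr
        linarith
      exact le_trans (by positivity) (le_accuratePotential ha he hκ hn hx)
    · exact integrable_accuratePotential _ _ s _ _ _ _ _ _ _ _ _ _
    · have := integral_accuratePotential_le (c₀ := c₀) (e := e) (ε := ε) (N := N) (P := P) (c.rep j)
        (L (c.rep j)) s ha hκ (c.thr j) S n
      linarith [hdrift s]
    · exact fun n r S y hn hr hS _ => (hexc r hr.le).trans
        (le_accuratePotential_succ_add_sq ha he hκ hε hW hn hS y)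
    · exact fun n r S y hn hr hS => (hcomp r (S + y) hr).trans
        (le_accuratePotential_succ_add_sq ha he hκ hε hW (by omega) hS y)
    · exact fun n S y _ => le_add_of_nonneg_right (by positivity)
  refine (hp.restartValue_le hj hN (fun m s => by simp) hN1 hthr).trans_eq ?_
  simp [hg, accuratePotential]

end Accurate

end Blocks

/-! ### The regret of a phase -/

section Phases

variable {X : Type u} {A : Type v} [MeasurableSpace X] [MeasurableSpace A] {K : ℕ} {d : Fin K → ℕ}

/-- The width of the upper confidence bound after a block of the arm `k` in phase `b`, if the arm is
well-specified and its regret is at most `C * 2 ^ k * √t` over `t` rounds. -/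
def Config.accuracy (c : Config K) (C : ℝ) (k b : ℕ) : ℝ :=
  (2 * (C * 2 ^ k) + c.conf) / √(c.len b k)

/-- The bound of the regret of a block of a well-specified arm in phase `b`. -/
def blockCost (T : ℕ) (C R : ℝ) (b : ℕ) : ℝ := 2 * (C * R + 1) * 2 ^ b * √T

variable (P : Problem X A d) (L : Fin K → BaseLearner.{u, v, w} X A) (c : Config K)

/-- The regret of a block of the arm `j` in phase `b` is at most `M` if the upper confidence bound
is accurate up to `ε`: up to `e`, the regret `ρ` of a round is paid for by the excess `ρ - ε` of the
loss over the bound, which is limited by the threshold. -/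
def IsDetectable (T b j : ℕ) (ε M : ℝ) : Prop :=
  ∃ a e : ℝ, 0 ≤ a ∧ 0 ≤ e ∧
    (∀ s, roundRegret P (c.rep j) (L (c.rep j)) s ≤
      a * (roundRegret P (c.rep j) (L (c.rep j)) s - ε) + e) ∧
    a * (c.thr j + 21 * √T) + e * c.len b j ≤ M

/-- The relations between the parameters of the strategy which the analysis uses. The learners of
the arms `j ≥ k` are well-specified, and their regret over `t` rounds is of order `2 ^ j * √t`. -/
structure Calibrated (T k Q : ℕ) (C R l : ℝ) : Prop where
  one_le_T : 1 ≤ T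
  one_le_C : 1 ≤ C
  one_le_R : 1 ≤ R
  l_nonneg : 0 ≤ l
  copies_pos : 0 < c.copies
  le_two_pow_copies : (T : ℝ) ≤ 2 ^ c.copies
  copies_mul_top_le : c.copies * c.top ≤ Q
  sqrt_le_two_pow : √T ≤ 2 ^ (c.top + 1)
  one_le_len : ∀ b j, j ≤ c.top → 1 ≤ c.len b j
  len_le : ∀ b j, c.len b j ≤ T
  len_self : ∀ b ≤ c.top, c.len b b = T
  mul_sqrt_len_le : ∀ b j, j ≤ c.top → 2 ^ j * √(c.len b j) ≤ R * 2 ^ b * √T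
  thr_eq : ∀ j, c.thr j = 2 ^ (j + 1) * (2 * (Q + 1) * (C * R)) * √T
  conf_nonneg : 0 ≤ c.conf
  tail_le : T * Real.exp (l ^ 2 - l * c.conf) ≤ 1
  wellSpecified : ∀ j, k ≤ j → P.iStar ≤ c.rep j
  soloRegret_le : ∀ j, k ≤ j → ∀ t ≤ T,
    soloRegret P (c.rep j) (L (c.rep j)) t + 3 * √t ≤ C * 2 ^ j * √t

lemma wellSpecifiedPotential_start_le {N : ℕ} (hN : 1 ≤ N) {a c₃ : ℝ} (ha : 0 ≤ a)
    (c₀ l x v : ℝ) :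
    wellSpecifiedPotential c₀ a c₃ (1 / √N) (l / √N) (x * √N) v N 0 0 ≤
      c₀ + a * (3 * √N) + c₃ * Real.exp (l ^ 2 - l * x) := by
  have hN' : (0 : ℝ) < N := by exact_mod_cast hN
  have hsq (y : ℝ) : (y / √N) ^ 2 * N = y ^ 2 := by
    rw [div_pow, Real.sq_sqrt hN'.le, div_mul_cancel₀ _ hN'.ne']
  have hexp : Real.exp (-(l / √N) * (x * √N)) * Real.exp (l ^ 2) =
      Real.exp (l ^ 2 - l * x) := by
    rw [← Real.exp_add]
    congr 1
    field_simp
    ring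
  have hthree : Real.exp 1 * √N ≤ 3 * √N := by
    gcongr
    exact Real.exp_one_lt_d9.le.trans (by norm_num)
  simp only [wellSpecifiedPotential, posPartPotential, expPotential, Nat.cast_zero, zero_mul,
    sub_zero, mul_zero, zero_add, hsq, one_pow, div_div_eq_mul_div, div_one, mul_assoc, hexp]
  gcongr

lemma restartValue_le_horizon {T r : ℕ} (hr : r ≤ T) (σ : BlockState) :
    restartValue P L c.rule r σ ≤ T :=
  (restartValue_le P L c.rule r σ).trans (by exact_mod_cast hr)

/-- The new bound fails to be valid or accurate only if the losses in the block are untypically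
small or large. -/
lemma restartValue_newBound_le {T b q N r : ℕ} {S W E c₀ c₂ : ℝ} (hN : 1 ≤ N) (hW : P.value ≤ W)
    (hc₀ : 0 ≤ c₀) (hc₂ : 0 ≤ c₂) (hr : r ≤ T)
    (hcomp : ∀ W', P.value ≤ W' → W' ≤ W → restartValue P L c.rule r (blockStart b q W') ≤
      c₀ + (if P.value + (2 * E + c.conf) / √N < W' then c₂ else 0)) :
    restartValue P L c.rule r (blockStart b q (c.newBound N S W)) ≤
      c₀ + (if 2 * (E * √N) < S - N * P.value then c₂ else 0) +
        (if S - N * P.value < -(c.conf * √N) then (T : ℝ) else 0) := by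
  by_cases hsmall : S - N * P.value < -(c.conf * √N)
  · rw [if_pos hsmall]
    have : 0 ≤ if 2 * (E * √N) < S - N * P.value then c₂ else 0 := by split_ifs <;> positivity
    linarith [restartValue_le_horizon P L c hr (blockStart b q (c.newBound N S W))]
  · rw [if_neg hsmall, add_zero]
    refine (hcomp _ (c.le_newBound hN hW (not_lt.1 hsmall)) (c.newBound_le N S W)).trans ?_
    by_cases hlarge : 2 * (E * √N) < S - N * P.value
    · rw [if_pos hlarge]
      gcongr
      split_ifs <;> linarith
    · rw [if_neg hlarge, if_neg (not_lt.2 (c.newBound_le_add hN ?_))]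
      linarith

namespace Calibrated

variable {P L c} {T k Q : ℕ} {C R l : ℝ} (h : Calibrated P L c T k Q C R l)
include h

lemma one_le_sqrt : 1 ≤ √(T : ℝ) := Real.one_le_sqrt.2 (by exact_mod_cast h.one_le_T)

lemma mul_pos : 0 < C * R := by
  have := h.one_le_C
  have := h.one_le_R
  positivity

lemma thr_pos (j : ℕ) : 0 < c.thr j := by
  have := h.one_le_sqrt
  have := h.mul_pos
  rw [h.thr_eq]
  positivity

lemma blockCost_nonneg (b : ℕ) : 0 ≤ blockCost T C R b := by
  have := h.mul_pos
  unfold blockCost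
  positivity

lemma accuracy_nonneg (b : ℕ) : 0 ≤ c.accuracy C k b := by
  have := h.one_le_C
  have := h.conf_nonneg
  unfold Config.accuracy
  positivity

lemma copies_mul_le {n : ℕ} (hn : n ≤ c.top) : ((c.copies * n : ℕ) : ℝ) ≤ Q := by
  exact_mod_cast (Nat.mul_le_mul_left _ hn).trans h.copies_mul_top_le

lemma restartValue_blockStart_le {b q j N r₀ : ℕ} {W c₀ c₁ c₂ : ℝ} (hj : c.arm b q = j)
    (hN : c.len b j = N) (hk : k ≤ j) (htop : j ≤ c.top) (hW : P.value ≤ W) (hc₀ : 0 ≤ c₀)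
    (hc₁ : 0 ≤ c₁) (hc₂ : 0 ≤ c₂) (hr₀ : r₀ ≤ T)
    (hexc : ∀ r ≤ T, restartValue P L c.rule r (c.phaseStart (j + 1)) ≤ c₁)
    (hcomp : ∀ r W', r + N = r₀ → P.value ≤ W' → W' ≤ W →
      restartValue P L c.rule r (blockStart b (q - 1) W') ≤
        c₀ + (if P.value + (2 * (C * 2 ^ j) + c.conf) / √N < W' then c₂ else 0)) :
    restartValue P L c.rule r₀ (blockStart b q W) ≤
      C * 2 ^ j * √N + c₁ * (C * 2 ^ j * √N / c.thr j) + c₀ + c₂ / 2 + 1 := by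
  have hN1 : 1 ≤ N := hN ▸ h.one_le_len b j htop
  have hC := h.one_le_C
  have hthr := h.thr_pos j
  set E := C * 2 ^ j * √N
  have hEpos : 0 < E := by positivity
  set a := c₁ / c.thr j + c₂ / (2 * E) with ha_def
  have ha : 0 ≤ a := by positivity
  have hblock := restartValue_le_of_wellSpecified (c₃ := T) (t := 1 / √N) (l := l / √N)
    (h.wellSpecified j hk) hj hN hN1 hW hthr hEpos hc₀ hc₁ hc₂ (by positivity) (by positivity)
    (div_nonneg h.l_nonneg (Real.sqrt_nonneg _)) (fun r hr => hexc r (hr.trans hr₀))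
    fun r S hr => restartValue_newBound_le P L c hN1 hW hc₀ hc₂ (by omega) fun W' => hcomp r W' hr
  have hstart := wellSpecifiedPotential_start_le (c₃ := T) hN1 ha c₀ l c.conf P.value
  have hsolo := h.soloRegret_le j hk N (hN ▸ h.len_le b j)
  have hsolo_mul : a * (soloRegret P (c.rep j) (L (c.rep j)) N + 3 * √N) ≤ a * E := by gcongr
  have haE : a * E = c₁ * (E / c.thr j) + c₂ / 2 := by
    rw [ha_def]
    field_simp
  have hsqrt := Real.sqrt_nonneg (N : ℝ)
  linarith [h.tail_le]

lemma mul_sqrt_len_le_blockCost {b j : ℕ} (htop : j ≤ c.top) :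
    C * 2 ^ j * √(c.len b j) ≤ C * R * 2 ^ b * √T := by
  have := mul_le_mul_of_nonneg_left (h.mul_sqrt_len_le b j htop) (zero_le_one.trans h.one_le_C)
  linarith

/-- The threshold is large enough for a false alarm to cost no more than the regret of the learner
in the block. -/
lemma mul_blockCost_mul_div_thr_le {b j : ℕ} (htop : j ≤ c.top) :
    (Q + 1) * blockCost T C R (j + 1) * (C * 2 ^ j * √(c.len b j) / c.thr j) ≤
      (C * R + 1) * 2 ^ b * √T := by
  have hCR := h.mul_pos
  have hT := h.one_le_sqrt
  rw [h.thr_eq, ← mul_div_assoc, div_le_iff₀ (by positivity), blockCost]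
  have := mul_le_mul_of_nonneg_left (h.mul_sqrt_len_le_blockCost (b := b) htop)
    (show 0 ≤ 2 * ((Q : ℝ) + 1) * (C * R + 1) * 2 ^ (j + 1) * √T by positivity)
  linarith

lemma restartValue_blockStart_le_blockCost {b q j r₀ : ℕ} {W c₀ c₂ : ℝ} (hj : c.arm b q = j)
    (hk : k ≤ j) (htop : j ≤ c.top) (hW : P.value ≤ W) (hc₀ : 0 ≤ c₀) (hc₂ : 0 ≤ c₂) (hr₀ : r₀ ≤ T)
    (hexc : ∀ r ≤ T, restartValue P L c.rule r (c.phaseStart (j + 1)) ≤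
      (Q + 1) * blockCost T C R (j + 1))
    (hcomp : ∀ r W', r + c.len b j = r₀ → P.value ≤ W' → W' ≤ W →
      restartValue P L c.rule r (blockStart b (q - 1) W') ≤
        c₀ + (if P.value + c.accuracy C j b < W' then c₂ else 0)) :
    restartValue P L c.rule r₀ (blockStart b q W) ≤ blockCost T C R b + c₀ + c₂ / 2 := by
  have hblock := h.restartValue_blockStart_le hj rfl hk htop hW hc₀
    (mul_nonneg (by positivity) (h.blockCost_nonneg _)) hc₂ hr₀ hexc hcomp
  have hone : (1 : ℝ) ≤ 2 ^ b * √T :=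
    one_le_mul_of_one_le_of_one_le (one_le_pow₀ (by norm_num)) h.one_le_sqrt
  have := h.mul_blockCost_mul_div_thr_le (b := b) htop
  have := h.mul_sqrt_len_le_blockCost (b := b) htop
  unfold blockCost at *
  linarith

lemma restartValue_blockStart_le_of_isDetectable {b q j r₀ : ℕ} {W ε M c₀ : ℝ}
    (hj : c.arm b q = j) (htop : j ≤ c.top) (hε : 0 ≤ ε) (hW : W ≤ P.value + ε) (hc₀ : 0 ≤ c₀)
    (hr₀ : r₀ ≤ T) (hdet : IsDetectable P L c T b j ε M)
    (hexc : ∀ r ≤ T, restartValue P L c.rule r (c.phaseStart (j + 1)) ≤ c₀)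
    (hcomp : ∀ r W', r + c.len b j = r₀ → W' ≤ P.value + ε →
      restartValue P L c.rule r (blockStart b (q - 1) W') ≤ c₀) :
    restartValue P L c.rule r₀ (blockStart b q W) ≤ M + c₀ := by
  obtain ⟨a, e, ha, he, hdrift, hM⟩ := hdet
  have hT : 0 < √(T : ℝ) := zero_lt_one.trans_le h.one_le_sqrt
  have hblock := restartValue_le_of_accurate (r₀ := r₀) (κ := √T) hj rfl (h.one_le_len b j htop)
    (h.thr_pos j).le hε hW ha he hT hc₀ hdrift (fun r hr => hexc r (hr.trans hr₀))
    fun r S hr => hcomp r _ hr ((c.newBound_le _ _ _).trans hW)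
  have hlen : 20 * a / √T * c.len b j ≤ 20 * a * √T := calc
    20 * a / √T * c.len b j ≤ 20 * a / √T * T := by
      gcongr
      exact h.len_le b j
    _ = 20 * a * √T := by rw [div_mul_eq_mul_div, mul_div_assoc, Real.div_sqrt]
  linarith

lemma restartValue_after_commit {b r r₀ : ℕ} (hb : b ≤ c.top) (hr₀ : r₀ ≤ T)
    (hr : r + c.len b b = r₀) (σ : BlockState) : restartValue P L c.rule r σ = 0 := by
  rw [h.len_self b hb] at hr
  rw [show r = 0 by omega, restartValue_zero]

lemma restartValue_explore_le {b q₀ : ℕ} {Y : ℝ} (hb : b ≤ c.top) (hY : 0 ≤ Y)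
    (harm : ∀ q, q₀ < q → k ≤ c.arm b q)
    (hphase : ∀ j, k ≤ j → b ≤ j → ∀ r ≤ T,
      restartValue P L c.rule r (c.phaseStart (j + 1)) ≤ (Q + 1) * blockCost T C R (j + 1))
    (hstart : ∀ r ≤ T, ∀ W, P.value ≤ W → restartValue P L c.rule r (blockStart b q₀ W) ≤ Y)
    (m : ℕ) (hm : q₀ + m ≤ c.copies * (c.top - b)) (r : ℕ) (hr : r ≤ T) (W : ℝ)
    (hW : P.value ≤ W) :
    restartValue P L c.rule r (blockStart b (q₀ + m) W) ≤ m * blockCost T C R b + Y := by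
  have hB := h.blockCost_nonneg b
  induction m generalizing r W with
  | zero => simpa using hstart r hr W hW
  | succ m ih =>
    have hk := harm (q₀ + (m + 1)) (by omega)
    have htop := c.arm_le (b := b) h.copies_pos hm
    have hblock := h.restartValue_blockStart_le_blockCost (c₀ := m * blockCost T C R b + Y)
      (c₂ := 0) (q := q₀ + (m + 1)) rfl hk (by omega) hW (by positivity) le_rfl hr
      (hphase _ hk (c.le_arm b _)) fun r' W' hr' hW' _ => by
        simpa using ih (by omega) r' (by omega) W' hW'
    push_cast
    linarith

lemma restartValue_phaseStart_le_of_top_lt {b r : ℕ} (htop : c.top < b) (hr : r ≤ T) :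
    restartValue P L c.rule r (c.phaseStart b) ≤ (Q + 1) * blockCost T C R b := by
  have hCR := h.mul_pos
  calc restartValue P L c.rule r (c.phaseStart b)
      ≤ √T * √T := (restartValue_le_horizon P L c hr _).trans_eq
        (Real.mul_self_sqrt (Nat.cast_nonneg T)).symm
    _ ≤ 2 ^ b * √T := by
        gcongr
        exact h.sqrt_le_two_pow.trans (pow_le_pow_right₀ (by norm_num) htop)
    _ ≤ (Q + 1) * (2 * (C * R + 1)) * (2 ^ b * √T) := by
        refine le_mul_of_one_le_left (by positivity) ?_
        exact one_le_mul_of_one_le_of_one_le (by simp) (by linarith)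
    _ = (Q + 1) * blockCost T C R b := by
        unfold blockCost
        ring

lemma restartValue_phaseStart_le_of_le {b : ℕ} (hb : k ≤ b) {r : ℕ} (hr : r ≤ T) :
    restartValue P L c.rule r (c.phaseStart b) ≤ (Q + 1) * blockCost T C R b := by
  induction hn : c.top + 1 - b using Nat.strong_induction_on generalizing b r with
  | _ n ih =>
  rcases Nat.lt_or_ge c.top b with htop | htop
  · exact h.restartValue_phaseStart_le_of_top_lt htop hr
  have hB := h.blockCost_nonneg b
  have hphase (j : ℕ) (hj : b ≤ j) (r : ℕ) (hr : r ≤ T) :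
      restartValue P L c.rule r (c.phaseStart (j + 1)) ≤ (Q + 1) * blockCost T C R (j + 1) :=
    ih (c.top + 1 - (j + 1)) (by omega) (by omega) hr rfl
  have hcommit (r : ℕ) (hr : r ≤ T) (W : ℝ) (hW : P.value ≤ W) :
      restartValue P L c.rule r (blockStart b 0 W) ≤ blockCost T C R b := by
    simpa using h.restartValue_blockStart_le_blockCost (c₀ := 0) (c₂ := 0)
      (c.arm_zero b h.copies_pos) hb htop hW le_rfl le_rfl hr (hphase b le_rfl)
      fun r' W' hr' _ _ => by simp [h.restartValue_after_commit htop hr hr']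
  have hexplore := h.restartValue_explore_le htop hB (fun q _ => hb.trans (c.le_arm b q))
    (fun j _ => hphase j) hcommit _ (zero_add _).le r hr 1 P.value_le_one
  rw [zero_add] at hexplore
  have := mul_le_mul_of_nonneg_right (h.copies_mul_le (Nat.sub_le c.top b)) hB
  unfold Config.phaseStart
  linarith

section Misspecified

variable {b : ℕ} {M F : ℝ}

lemma restartValue_misspecified_le (hb : b < k) (hk : k ≤ c.top) (hM : 0 ≤ M) (hF : 0 ≤ F)
    (hdet : ∀ j, b ≤ j → j < k → IsDetectable P L c T b j (c.accuracy C k b) M)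
    (hnext : ∀ j, b ≤ j → j < k → ∀ r ≤ T, restartValue P L c.rule r (c.phaseStart (j + 1)) ≤ F)
    (q : ℕ) (hq : q ≤ c.copies * (k - b - 1)) (r : ℕ) (hr : r ≤ T) (W : ℝ)
    (hW : W ≤ P.value + c.accuracy C k b) :
    restartValue P L c.rule r (blockStart b q W) ≤ (q + 1) * M + F := by
  have hε := h.accuracy_nonneg b
  induction q generalizing r W with
  | zero =>
    have := h.restartValue_blockStart_le_of_isDetectable (c.arm_zero b h.copies_pos) (by omega) hε
      hW hF hr (hdet b le_rfl hb) (hnext b le_rfl hb) fun r' W' hr' _ => by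
        rwa [h.restartValue_after_commit (by omega) hr hr']
    simpa using this
  | succ q ih =>
    have hlt := c.arm_le (b := b) h.copies_pos hq
    have hle := c.le_arm b (q + 1)
    have hY : 0 ≤ ((q : ℝ) + 1) * M := by positivity
    have := h.restartValue_blockStart_le_of_isDetectable (c₀ := (q + 1) * M + F) rfl (by omega) hε
      hW (by positivity) hr (hdet (c.arm b (q + 1)) hle (by omega))
      (fun r hr => (hnext _ hle (by omega) r hr).trans (le_add_of_nonneg_left hY))
      fun r' W' hr' hW' => ih (by omega) r' (by omega) W' hW'
    push_cast
    linarith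

/-- Every block of the arm `k` makes the bound accurate with probability at least `1 / 2`. -/
lemma restartValue_best_le (hb : b < k) (hk : k ≤ c.top) {Y : ℝ} (hY : 0 ≤ Y)
    (hstart : ∀ r ≤ T, ∀ W ≤ P.value + c.accuracy C k b,
      restartValue P L c.rule r (blockStart b (c.copies * (k - b - 1)) W) ≤ Y)
    (m : ℕ) (hm : m ≤ c.copies) (r : ℕ) (hr : r ≤ T) (W : ℝ) (hW : P.value ≤ W) :
    restartValue P L c.rule r (blockStart b (c.copies * (k - b - 1) + m) W) ≤
      m * blockCost T C R b + Y +
        (if P.value + c.accuracy C k b < W then (T : ℝ) / 2 ^ m else 0) := by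
  have hB := h.blockCost_nonneg b
  induction m generalizing r W with
  | zero =>
    split_ifs with haccurate
    · have := restartValue_le_horizon P L c hr (blockStart b (c.copies * (k - b - 1) + 0) W)
      simp only [pow_zero, div_one, Nat.cast_zero, zero_mul]
      linarith
    · simpa using hstart r hr W (not_lt.1 haccurate)
  | succ m ih =>
    have harm : c.arm b (c.copies * (k - b - 1) + (m + 1)) = k := by
      have hgt := c.lt_arm (b := b) (q := c.copies * (k - b - 1) + (m + 1)) (k := k - b - 1)
        h.copies_pos (by omega)
      have hle := c.arm_le (b := b) (q := c.copies * (k - b - 1) + (m + 1)) (k := k - b - 1 + 1)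
        h.copies_pos (by rw [Nat.mul_succ]; omega)
      omega
    have hblock := h.restartValue_blockStart_le_blockCost (c₀ := m * blockCost T C R b + Y)
      (c₂ := if P.value + c.accuracy C k b < W then (T : ℝ) / 2 ^ m else 0) harm le_rfl hk hW
      (by positivity) (by split_ifs <;> positivity) hr
      (fun r hr => h.restartValue_phaseStart_le_of_le (by omega) hr) fun r' W' hr' hW' hWW => by
        refine (ih (by omega) r' (by omega) W' hW').trans_eq ?_
        congr 1
        by_cases hlt : P.value + c.accuracy C k b < W'
        · rw [if_pos hlt, if_pos (hlt.trans_le hWW), if_pos hlt]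
        · rw [if_neg hlt, if_neg hlt]
    refine hblock.trans_eq ?_
    rw [ite_div, zero_div, div_div, ← pow_succ]
    push_cast
    ring

lemma restartValue_phaseStart_le_of_lt (hb : b < k) (hk : k ≤ c.top) (hM : 0 ≤ M) (hF : 0 ≤ F)
    (hdet : ∀ j, b ≤ j → j < k → IsDetectable P L c T b j (c.accuracy C k b) M)
    (hnext : ∀ j, b ≤ j → j < k → ∀ r ≤ T, restartValue P L c.rule r (c.phaseStart (j + 1)) ≤ F)
    {r : ℕ} (hr : r ≤ T) :
    restartValue P L c.rule r (c.phaseStart b) ≤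
      (Q + 1) * blockCost T C R b + (Q + 1) * M + F + 1 := by
  have hB := h.blockCost_nonneg b
  have hpow : (T : ℝ) / 2 ^ c.copies ≤ 1 := (div_le_one (by positivity)).2 h.le_two_pow_copies
  have hblocks : c.copies * (k - b - 1) + c.copies = c.copies * (k - b) := by
    rw [← Nat.mul_succ]
    congr 1
    omega
  have hsplit : c.copies * (k - b) + c.copies * (c.top - k) = c.copies * (c.top - b) := by
    rw [← Nat.mul_add]
    congr 1
    omega
  set Y := (Q + 1) * M + F
  have hmis (r : ℕ) (hr : r ≤ T) (W : ℝ) (hW : W ≤ P.value + c.accuracy C k b) :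
      restartValue P L c.rule r (blockStart b (c.copies * (k - b - 1)) W) ≤ Y := by
    have hQ := mul_le_mul_of_nonneg_right (h.copies_mul_le (show k - b - 1 ≤ c.top by omega)) hM
    linarith [h.restartValue_misspecified_le hb hk hM hF hdet hnext _ le_rfl r hr W hW]
  have hbest (r : ℕ) (hr : r ≤ T) (W : ℝ) (hW : P.value ≤ W) :
      restartValue P L c.rule r (blockStart b (c.copies * (k - b)) W) ≤
        c.copies * blockCost T C R b + Y + 1 := by
    have := h.restartValue_best_le hb hk (by positivity) hmis c.copies le_rfl r hr W hW
    rw [hblocks] at this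
    refine this.trans ?_
    gcongr
    split_ifs
    exacts [hpow, zero_le_one]
  have hexplore := h.restartValue_explore_le (by omega) (by positivity)
    (fun q hq => by have := c.lt_arm (b := b) h.copies_pos hq; omega)
    (fun j hj _ r hr => h.restartValue_phaseStart_le_of_le (by omega) hr) hbest
    _ hsplit.le r hr 1 P.value_le_one
  rw [hsplit] at hexplore
  have hcount : ((c.copies * (c.top - k) : ℕ) : ℝ) + c.copies ≤ Q := by
    have : c.copies * (c.top - k) + c.copies = c.copies * (c.top - k + 1) := (Nat.mul_succ _ _).symm
    have := h.copies_mul_le (show c.top - k + 1 ≤ c.top by omega)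
    push_cast at this ⊢
    linarith
  have := mul_le_mul_of_nonneg_right hcount hB
  unfold Config.phaseStart
  linarith

end Misspecified

lemma restartValue_phaseStart_le (hk : k ≤ c.top) {M : ℝ} (hM : 0 ≤ M) {b₀ : ℕ}
    (hdet : ∀ b j, b₀ ≤ b → b ≤ j → j < k → IsDetectable P L c T b j (c.accuracy C k b) M)
    {b : ℕ} (hb₀ : b₀ ≤ b) (hb : b ≤ k) {r : ℕ} (hr : r ≤ T) :
    restartValue P L c.rule r (c.phaseStart b) ≤
      (k - b : ℕ) * ((Q + 1) * blockCost T C R k + (Q + 1) * M + 1) +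
        (Q + 1) * blockCost T C R k := by
  induction hn : k - b using Nat.strong_induction_on generalizing b r with
  | _ n ih =>
  rcases hb.eq_or_lt with rfl | hlt
  · obtain rfl : n = 0 := by omega
    simpa using h.restartValue_phaseStart_le_of_le le_rfl hr
  set G := (Q + 1) * blockCost T C R k with hG_def
  have hG : 0 ≤ G := mul_nonneg (by positivity) (h.blockCost_nonneg k)
  have hphase := h.restartValue_phaseStart_le_of_lt hlt hk hM
    (F := (n - 1 : ℕ) * (G + (Q + 1) * M + 1) + G) (by positivity)
    (fun j => hdet b j hb₀) (fun j hbj hjk r hr => by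
      have hlen : ((k - (j + 1) : ℕ) : ℝ) ≤ (n - 1 : ℕ) := by
        exact_mod_cast (by omega : k - (j + 1) ≤ n - 1)
      refine (ih (k - (j + 1)) (by omega) (by omega) (by omega) hr rfl).trans ?_
      exact add_le_add_left (mul_le_mul_of_nonneg_right hlen (by positivity)) G) hr
  have hmono : (Q + 1) * blockCost T C R b ≤ G := by
    have := h.mul_pos
    rw [hG_def]
    unfold blockCost
    gcongr
    norm_num
  have hn' : (n : ℝ) = (n - 1 : ℕ) + 1 := by
    rw [Nat.cast_sub (by omega)]
    simp
  rw [hn']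
  linarith

end Calibrated

end Phases

/-! ### The parameters of the strategy -/

lemma four_pow_eq_sq (n : ℕ) : (4 : ℝ) ^ n = (2 ^ n) ^ 2 := by
  rw [pow_right_comm]
  norm_num

lemma sqrt_le_two_pow_log_succ (T : ℕ) : √(T : ℝ) ≤ 2 ^ (Nat.log 4 T + 1) := by
  refine Real.sqrt_le_iff.2 ⟨by positivity, ?_⟩
  rw [← four_pow_eq_sq]
  exact_mod_cast (Nat.lt_pow_succ_log_self (by norm_num) T).le

/-- The length of a block, of order `T * 4 ^ m / 4 ^ k`: there the regret `2 ^ k * √N` of a learner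
of order `2 ^ k` is at most `2 ^ m * √T`. -/
def blockLen (T m k : ℕ) : ℕ := min T (T * 4 ^ m / 4 ^ k)

lemma blockLen_le (T m k : ℕ) : blockLen T m k ≤ T := min_le_left _ _

section BlockLen

variable {T k : ℕ} (m : ℕ)

lemma blockLen_eq_self {m : ℕ} (hk : k ≤ m) : blockLen T m k = T := by
  refine min_eq_left ((Nat.le_div_iff_mul_le (by positivity)).2 ?_)
  exact Nat.mul_le_mul_left _ (Nat.pow_le_pow_right (by norm_num) hk)

lemma one_le_blockLen (hT : 1 ≤ T) (hk : k ≤ Nat.log 4 T) : 1 ≤ blockLen T m k := by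
  refine le_min hT ((Nat.one_le_div_iff (by positivity)).2 ?_)
  exact (Nat.pow_le_of_le_log (by omega) hk).trans (Nat.le_mul_of_pos_right _ (by positivity))

lemma mul_sqrt_blockLen_le : 2 ^ k * √(blockLen T m k) ≤ 2 ^ m * √T := by
  have hlen : blockLen T m k * 4 ^ k ≤ T * 4 ^ m :=
    (Nat.mul_le_mul_right _ (min_le_right _ _)).trans (Nat.div_mul_le_self _ _)
  have hlen' : (blockLen T m k : ℝ) * 4 ^ k ≤ T * 4 ^ m := by exact_mod_cast hlen
  refine le_of_sq_le_sq ?_ (by positivity)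
  rw [mul_pow, mul_pow, Real.sq_sqrt (Nat.cast_nonneg _), Real.sq_sqrt (Nat.cast_nonneg _),
    ← four_pow_eq_sq, ← four_pow_eq_sq]
  linarith

lemma blockLen_mul_two_pow_le : (blockLen T m k : ℝ) * 2 ^ k ≤ 2 ^ m * T := calc
  (blockLen T m k : ℝ) * 2 ^ k = √(blockLen T m k) * (2 ^ k * √(blockLen T m k)) := by
    rw [mul_left_comm, Real.mul_self_sqrt (Nat.cast_nonneg _), mul_comm]
  _ ≤ √T * (2 ^ m * √T) := by
    refine mul_le_mul ?_ (mul_sqrt_blockLen_le m) (by positivity) (by positivity)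
    exact Real.sqrt_le_sqrt (by exact_mod_cast blockLen_le T m k)
  _ = 2 ^ m * T := by rw [mul_left_comm, Real.mul_self_sqrt (Nat.cast_nonneg _)]

lemma sqrt_div_sqrt_blockLen_le (hT : 1 ≤ T) (hk : k ≤ Nat.log 4 T) :
    √T / √(blockLen T m k) ≤ 1 + 2 * 2 ^ k / 2 ^ m := by
  have hN := one_le_blockLen m hT hk
  have hsqrt : 0 < √(blockLen T m k : ℝ) := Real.sqrt_pos.2 (by exact_mod_cast hN)
  rcases min_choice T (T * 4 ^ m / 4 ^ k) with h | h
  · rw [blockLen, h, div_self (by positivity)]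
    exact le_add_of_nonneg_right (by positivity)
  · have hlt : T * 4 ^ m < (blockLen T m k + 1) * 4 ^ k := by
      rw [blockLen, h, mul_comm _ (4 ^ k)]
      exact Nat.lt_mul_div_succ _ (by positivity)
    have hlt' : (T : ℝ) * 4 ^ m < (blockLen T m k + 1) * 4 ^ k := by exact_mod_cast hlt
    have hle : ((blockLen T m k : ℝ) + 1) * 4 ^ k ≤ 4 * blockLen T m k * 4 ^ k := by
      have : (1 : ℝ) ≤ blockLen T m k := by exact_mod_cast hN
      gcongr
      linarith
    refine le_trans ((div_le_div_iff₀ hsqrt (by positivity)).2 ?_)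
      (le_add_of_nonneg_left zero_le_one)
    refine le_of_sq_le_sq ?_ (by positivity)
    rw [mul_pow, mul_pow, mul_pow, Real.sq_sqrt (Nat.cast_nonneg _),
      Real.sq_sqrt (Nat.cast_nonneg _), ← four_pow_eq_sq, ← four_pow_eq_sq]
    linarith

end BlockLen

/-- The order of the regret of the base learners, up to a dyadic factor. -/
def regretFactor (C : ℝ) (p T : ℕ) : ℝ := 2 * C * (1 + Real.log T) ^ p + 3

/-- The relative accuracy of the bounds of the optimal value. -/
def accuracyFactor (C : ℝ) (p T : ℕ) : ℝ := 2 * regretFactor C p T + (2 + Real.log T)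

/-- Exploration blocks in phase `b` have the length that suits learners of order
`2 ^ (b + explorationExponent C p T)`; then the new bound is accurate enough to detect a learner
whose regret exceeds the gap. -/
def explorationExponent (C : ℝ) (p T : ℕ) : ℕ := Nat.clog 2 ⌈4 * accuracyFactor C p T⌉₊

/-- The maximal number of exploration blocks in a phase. -/
def blockCount (T : ℕ) : ℕ := (Nat.log 2 T + 1) * Nat.log 4 T

/-- A common bound of all logarithmic factors. -/
def logBound (C : ℝ) (p T : ℕ) : ℝ := 80 * (C + 1) * (1 + Real.log T) ^ (p + 2)

section Factors

variable {C : ℝ} (p T : ℕ)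

lemma one_le_one_add_log : 1 ≤ 1 + Real.log T :=
  le_add_of_nonneg_right (Real.log_natCast_nonneg T)

lemma three_le_regretFactor (hC : 0 < C) : 3 ≤ regretFactor C p T := by
  have := one_le_one_add_log T
  exact le_add_of_nonneg_left (by positivity)

lemma regretFactor_le_accuracyFactor (hC : 0 < C) :
    regretFactor C p T ≤ accuracyFactor C p T := by
  have := three_le_regretFactor p T hC
  have := one_le_one_add_log T
  unfold accuracyFactor
  linarith

lemma four_mul_accuracyFactor_le : 4 * accuracyFactor C p T ≤ 2 ^ explorationExponent C p T :=
  (Nat.le_ceil _).trans (by exact_mod_cast Nat.le_pow_clog one_lt_two _)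

lemma two_pow_clog_lt {n : ℕ} (hn : 1 < n) : 2 ^ Nat.clog 2 n < 2 * n := by
  have hpred := Nat.pow_pred_clog_lt_self one_lt_two hn
  rw [← Nat.succ_pred_eq_of_pos (Nat.clog_pos one_lt_two hn), pow_succ']
  omega

lemma ten_mul_accuracyFactor_le_logBound (hC : 0 < C) :
    10 * accuracyFactor C p T ≤ logBound C p T := by
  have hl := one_le_one_add_log T
  set l := 1 + Real.log T with hl_def
  have hp : l ^ p ≤ l ^ (p + 2) := pow_le_pow_right₀ hl (by omega)
  have hl_le : l ≤ l ^ (p + 2) := le_self_pow₀ hl (by omega)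
  have hCp : C * l ^ p ≤ C * l ^ (p + 2) := by gcongr
  have hCl : 0 ≤ C * l ^ (p + 2) := by positivity
  have hlog : Real.log T = l - 1 := by rw [hl_def, add_sub_cancel_left]
  rw [accuracyFactor, regretFactor, logBound, ← hl_def, hlog]
  linarith

lemma two_pow_explorationExponent_le_logBound (hC : 0 < C) :
    2 ^ explorationExponent C p T ≤ logBound C p T := by
  have hG := (three_le_regretFactor p T hC).trans (regretFactor_le_accuracyFactor p T hC)
  have hceil : (⌈4 * accuracyFactor C p T⌉₊ : ℝ) < 4 * accuracyFactor C p T + 1 :=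
    Nat.ceil_lt_add_one (by linarith)
  have hone : 1 < ⌈4 * accuracyFactor C p T⌉₊ := Nat.lt_ceil.2 (by norm_num; linarith)
  have hpow : (2 : ℝ) ^ explorationExponent C p T < 2 * ⌈4 * accuracyFactor C p T⌉₊ := by
    exact_mod_cast two_pow_clog_lt hone
  linarith [ten_mul_accuracyFactor_le_logBound p T hC]

lemma blockCount_add_one_le : (blockCount T : ℝ) + 1 ≤ 2 * (1 + Real.log T) ^ 2 := by
  have hlog := Real.log_natCast_nonneg T
  have hlog2 : 1 / 2 ≤ Real.log (2 : ℕ) := by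
    push_cast
    linarith [Real.log_two_gt_d9]
  have hlog4 : 1 ≤ Real.log (4 : ℕ) := by
    rw [show (4 : ℕ) = 2 ^ 2 by norm_num, Nat.cast_pow, Real.log_pow]
    push_cast at hlog2 ⊢
    linarith
  have h2 : (Nat.log 2 T : ℝ) ≤ 2 * Real.log T := calc
    (Nat.log 2 T : ℝ) ≤ Real.log T / Real.log (2 : ℕ) := Real.natLog_le_logb T 2
    _ ≤ Real.log T / (1 / 2) := by gcongr
    _ = 2 * Real.log T := by ring
  have h4 : (Nat.log 4 T : ℝ) ≤ Real.log T :=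
    (Real.natLog_le_logb T 4).trans (div_le_self hlog hlog4)
  have hmul : ((Nat.log 2 T : ℝ) + 1) * Nat.log 4 T ≤ (2 * Real.log T + 1) * Real.log T := by
    gcongr
  unfold blockCount
  push_cast
  linarith

lemma blockCount_add_one_le_logBound (hC : 0 < C) :
    (blockCount T : ℝ) + 1 ≤ logBound C p T := by
  have hl := one_le_one_add_log T
  refine (blockCount_add_one_le T).trans ?_
  unfold logBound
  gcongr
  exacts [by linarith, by omega]

lemma thirty_le_logBound (hC : 0 < C) : 30 ≤ logBound C p T := by
  linarith [three_le_regretFactor p T hC, regretFactor_le_accuracyFactor p T hC,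
    ten_mul_accuracyFactor_le_logBound p T hC]

lemma regretFactor_mul_le (hC : 0 < C) :
    regretFactor C p T * 2 ^ explorationExponent C p T ≤ logBound C p T ^ 2 / 10 := by
  have hB := three_le_regretFactor p T hC
  have hG := regretFactor_le_accuracyFactor p T hC
  have hZ := ten_mul_accuracyFactor_le_logBound p T hC
  calc regretFactor C p T * 2 ^ explorationExponent C p T
      ≤ logBound C p T / 10 * logBound C p T := by
        gcongr
        · linarith
        · linarith
        · exact two_pow_explorationExponent_le_logBound p T hC
    _ = logBound C p T ^ 2 / 10 := by ring

end Factors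

section Arms

variable (α : ℝ) {K : ℕ} (d : Fin K → ℕ)

/-- The base learner with the largest index among those of order less than `2 ^ (j + 1)`. -/
def armLearner (hK : 0 < K) (j : ℕ) : Fin K :=
  if h : (Finset.univ.filter fun i => (d i : ℝ) ^ α < 2 ^ (j + 1)).Nonempty then
    (Finset.univ.filter fun i => (d i : ℝ) ^ α < 2 ^ (j + 1)).max' h
  else ⟨0, hK⟩

/-- The smallest arm that is represented by a base learner. -/
def firstArm : ℕ := sInf {b | ∃ i, (d i : ℝ) ^ α < 2 ^ (b + 1)}

/-- The parameters of the strategy for the horizon `T`. -/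
def config (C : ℝ) (p T : ℕ) (hK : 0 < K) : Config K where
  copies := Nat.log 2 T + 1
  top := Nat.log 4 T
  len b j := blockLen T (b + explorationExponent C p T) j
  thr j := 2 ^ (j + 1) * (2 * ((blockCount T : ℝ) + 1) *
    (regretFactor C p T * 2 ^ explorationExponent C p T)) * √T
  conf := 2 + Real.log T
  rep := armLearner α d hK
  first := firstArm α d

lemma exists_lt_two_pow_succ (x : ℝ) : ∃ b : ℕ, x < 2 ^ (b + 1) := by
  obtain ⟨n, hn⟩ := pow_unbounded_of_one_lt x one_lt_two
  exact ⟨n, hn.trans_le (pow_le_pow_right₀ one_le_two (Nat.le_succ n))⟩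

variable {α d} (hK : 0 < K)

lemma isGreatest_armLearner {j : ℕ} {i : Fin K} (hi : (d i : ℝ) ^ α < 2 ^ (j + 1)) :
    IsGreatest {i | (d i : ℝ) ^ α < 2 ^ (j + 1)} (armLearner α d hK j) := by
  have h : (Finset.univ.filter fun i => (d i : ℝ) ^ α < 2 ^ (j + 1)).Nonempty := ⟨i, by simpa⟩
  rw [armLearner, dif_pos h]
  simpa using Finset.isGreatest_max' _ h

lemma armLearner_lt_of_firstArm_le {j : ℕ} (hj : firstArm α d ≤ j) :
    (d (armLearner α d hK j) : ℝ) ^ α < 2 ^ (j + 1) := by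
  obtain ⟨b, hb⟩ := exists_lt_two_pow_succ ((d ⟨0, hK⟩ : ℝ) ^ α)
  obtain ⟨i, hi⟩ := Nat.sInf_mem (s := {b | ∃ i, (d i : ℝ) ^ α < 2 ^ (b + 1)}) ⟨b, ⟨0, hK⟩, hb⟩
  have hi' : (d i : ℝ) ^ α < 2 ^ (j + 1) :=
    hi.trans_le (pow_le_pow_right₀ one_le_two (Nat.succ_le_succ hj))
  exact (isGreatest_armLearner hK hi').1

end Arms

/-! ### Base learners with a regret bound -/

section Regret

variable {X : Type u} {A : Type v} [MeasurableSpace X] [MeasurableSpace A] {K : ℕ} {d : Fin K → ℕ}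
  (P : Problem X A d) (L : Fin K → BaseLearner.{u, v, w} X A)

/-- The guarantee for the well-specified base learners that corralling starts from. -/
def HasRegretBound (α C : ℝ) (p T : ℕ) : Prop :=
  ∀ i, P.iStar ≤ i → ∀ t ≤ T,
    soloRegret P i (L i) t ≤ C * (d i : ℝ) ^ α * √t * (1 + Real.log T) ^ p

namespace Problem

/-- The arm of the smallest well-specified base learner. -/
def bestArm (α : ℝ) : ℕ := sInf {b | (d P.iStar : ℝ) ^ α < 2 ^ (b + 1)}

variable {P} {α : ℝ}

lemma lt_two_pow_of_bestArm_le {j : ℕ} (hj : P.bestArm α ≤ j) :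
    (d P.iStar : ℝ) ^ α < 2 ^ (j + 1) := by
  have hmem := Nat.sInf_mem (s := {b | (d P.iStar : ℝ) ^ α < 2 ^ (b + 1)})
    (exists_lt_two_pow_succ _)
  exact lt_of_lt_of_le hmem (pow_le_pow_right₀ one_le_two (Nat.succ_le_succ hj))

lemma two_pow_bestArm_le (h : 0 < P.bestArm α) : 2 ^ P.bestArm α ≤ (d P.iStar : ℝ) ^ α := by
  have hnot := Nat.notMem_of_lt_sInf (s := {b | (d P.iStar : ℝ) ^ α < 2 ^ (b + 1)})
    (Nat.sub_lt h one_pos)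
  rw [Set.mem_ofPred_eq, not_lt] at hnot
  rwa [show P.bestArm α = P.bestArm α - 1 + 1 from (Nat.sub_add_cancel h).symm]

lemma firstArm_le_bestArm : firstArm α d ≤ P.bestArm α :=
  Nat.sInf_le ⟨P.iStar, lt_two_pow_of_bestArm_le le_rfl⟩

lemma armLearner_lt_iStar (hα : 0 ≤ α) (hK : 0 < K) {j : ℕ} (hj : firstArm α d ≤ j)
    (hjk : j < P.bestArm α) : armLearner α d hK j < P.iStar := by
  by_contra! hle
  have hlt := armLearner_lt_of_firstArm_le hK hj
  have hdim : (d P.iStar : ℝ) ^ α ≤ (d (armLearner α d hK j) : ℝ) ^ α :=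
    Real.rpow_le_rpow (by positivity) (by exact_mod_cast P.dim_mono hle) hα
  have hpow : (2 : ℝ) ^ (j + 1) ≤ 2 ^ P.bestArm α := pow_le_pow_right₀ one_le_two hjk
  linarith [two_pow_bestArm_le (P := P) (α := α) (by omega)]

end Problem

variable {P L} {α C : ℝ} {p T : ℕ}

namespace HasRegretBound

lemma soloRegret_armLearner_add_le (h : HasRegretBound P L α C p T) (hC : 0 < C) (hK : 0 < K)
    {j t : ℕ} (hj : P.bestArm α ≤ j) (ht : t ≤ T) :
    soloRegret P (armLearner α d hK j) (L (armLearner α d hK j)) t + 3 * √t ≤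
      regretFactor C p T * 2 ^ j * √t := by
  obtain ⟨hlt, hle⟩ := isGreatest_armLearner hK (Problem.lt_two_pow_of_bestArm_le hj)
  have := one_le_one_add_log T
  have hsolo : soloRegret P (armLearner α d hK j) (L (armLearner α d hK j)) t ≤
      C * 2 ^ (j + 1) * √t * (1 + Real.log T) ^ p := by
    refine (h _ (hle (Problem.lt_two_pow_of_bestArm_le hj)) t ht).trans ?_
    gcongr
    exact (show _ < _ from hlt).le
  have hthree : 3 * √(t : ℝ) ≤ 3 * 2 ^ j * √t := by
    gcongr
    exact le_mul_of_one_le_right (by norm_num) (one_le_pow₀ one_le_two)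
  unfold regretFactor
  rw [pow_succ] at hsolo
  linarith

lemma calibrated (h : HasRegretBound P L α C p T) (hC : 0 < C) (hT : 1 ≤ T) (hK : 0 < K) :
    Calibrated P L (config α d C p T hK) T (P.bestArm α) (blockCount T) (regretFactor C p T)
      (2 ^ explorationExponent C p T) (1 + Real.log T) where
  one_le_T := hT
  one_le_C := by linarith [three_le_regretFactor p T hC]
  one_le_R := one_le_pow₀ one_le_two
  l_nonneg := zero_le_one.trans (one_le_one_add_log T)
  copies_pos := Nat.succ_pos _
  le_two_pow_copies := by exact_mod_cast (Nat.lt_pow_succ_log_self one_lt_two T).le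
  copies_mul_top_le := le_rfl
  sqrt_le_two_pow := sqrt_le_two_pow_log_succ T
  one_le_len _ _ := one_le_blockLen _ hT
  len_le _ _ := blockLen_le _ _ _
  len_self _ _ := blockLen_eq_self (Nat.le_add_right _ _)
  mul_sqrt_len_le b _ _ := (mul_sqrt_blockLen_le _).trans_eq (by rw [pow_add, mul_comm (2 ^ b)])
  thr_eq _ := rfl
  conf_nonneg := add_nonneg zero_le_two (Real.log_natCast_nonneg T)
  tail_le := by
    have hT' : (0 : ℝ) < T := by exact_mod_cast hT
    have hexp : (1 + Real.log T) ^ 2 - (1 + Real.log T) * (2 + Real.log T) =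
        -Real.log T + -1 := by ring
    change T * Real.exp ((1 + Real.log T) ^ 2 - (1 + Real.log T) * (2 + Real.log T)) ≤ 1
    rw [hexp, Real.exp_add, Real.exp_neg, Real.exp_log hT', mul_inv_cancel_left₀ hT'.ne']
    exact Real.exp_le_one_iff.2 (by norm_num)
  wellSpecified _ hj := (isGreatest_armLearner hK (Problem.lt_two_pow_of_bestArm_le hj)).2
    (Problem.lt_two_pow_of_bestArm_le hj)
  soloRegret_le _ hj _ := h.soloRegret_armLearner_add_le hC hK hj

end HasRegretBound

lemma IsDetectable.mono {c : Config K} {b j : ℕ} {ε M M' : ℝ}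
    (h : IsDetectable P L c T b j ε M) (hM : M ≤ M') : IsDetectable P L c T b j ε M' := by
  obtain ⟨a, e, ha, he, hdrift, hle⟩ := h
  exact ⟨a, e, ha, he, hdrift, hle.trans hM⟩

end Regret

/-! ### Detecting misspecified learners -/

section Detection

variable {X : Type u} {A : Type v} [MeasurableSpace X] [MeasurableSpace A] {K : ℕ} {d : Fin K → ℕ}
  {P : Problem X A d} {L : Fin K → BaseLearner.{u, v, w} X A} {α C : ℝ} {p T : ℕ}
  (hC : 0 < C) (hT : 1 ≤ T) (hK : 0 < K) {b j k : ℕ}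

include hC in
lemma accuracy_nonneg : 0 ≤ (config α d C p T hK).accuracy (regretFactor C p T) k b := by
  have := three_le_regretFactor p T hC
  have : 0 ≤ (config α d C p T hK).conf := add_nonneg zero_le_two (Real.log_natCast_nonneg T)
  unfold Config.accuracy
  positivity

include hC hT in
lemma accuracy_mul_sqrt_le (hk : k ≤ Nat.log 4 T) :
    (config α d C p T hK).accuracy (regretFactor C p T) k b * √T ≤
      accuracyFactor C p T * 2 ^ k * (1 + 2 * 2 ^ k / 2 ^ (b + explorationExponent C p T)) := by
  have hnum : 2 * (regretFactor C p T * 2 ^ k) + (2 + Real.log T) ≤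
      accuracyFactor C p T * 2 ^ k := by
    have := le_mul_of_one_le_right (add_nonneg zero_le_two (Real.log_natCast_nonneg T))
      (one_le_pow₀ (n := k) (one_le_two (α := ℝ)))
    unfold accuracyFactor
    linarith
  have hA : 0 ≤ accuracyFactor C p T := by
    linarith [three_le_regretFactor p T hC, regretFactor_le_accuracyFactor p T hC]
  calc (config α d C p T hK).accuracy (regretFactor C p T) k b * √T
      = (2 * (regretFactor C p T * 2 ^ k) + (2 + Real.log T)) *
          (√T / √(blockLen T (b + explorationExponent C p T) k)) := by
        rw [Config.accuracy, div_mul_eq_mul_div, mul_div_assoc]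
        rfl
    _ ≤ _ := by
      gcongr
      exact sqrt_div_sqrt_blockLen_le _ hT hk

include hC hT in
lemma accuracy_mul_sqrt_le_four_pow (hk : k ≤ Nat.log 4 T) :
    (config α d C p T hK).accuracy (regretFactor C p T) k b * √T ≤
      3 * accuracyFactor C p T * 4 ^ k := by
  have hG : 0 ≤ accuracyFactor C p T := by
    linarith [three_le_regretFactor p T hC, regretFactor_le_accuracyFactor p T hC]
  have hone : (1 : ℝ) ≤ 2 ^ k := one_le_pow₀ one_le_two
  calc (config α d C p T hK).accuracy (regretFactor C p T) k b * √T
      ≤ accuracyFactor C p T * 2 ^ k *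
          (1 + 2 * 2 ^ k / 2 ^ (b + explorationExponent C p T)) :=
        accuracy_mul_sqrt_le hC hT hK hk
    _ ≤ accuracyFactor C p T * 2 ^ k * (2 ^ k + 2 * 2 ^ k) := by
      gcongr
      exact div_le_self (by positivity) (one_le_pow₀ one_le_two)
    _ = 3 * accuracyFactor C p T * 4 ^ k := by
      rw [four_pow_eq_sq]
      ring

include hC hT in
lemma accuracy_mul_sqrt_le_of_accuracyFactor_le (hk : k ≤ Nat.log 4 T)
    (hlarge : 4 * accuracyFactor C p T ≤ 2 ^ k) :
    (config α d C p T hK).accuracy (regretFactor C p T) k b * √T ≤ 3 / 4 * 4 ^ k := by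
  have hG : 0 < accuracyFactor C p T := by
    linarith [three_le_regretFactor p T hC, regretFactor_le_accuracyFactor p T hC]
  have hexp : 4 * accuracyFactor C p T ≤ 2 ^ (b + explorationExponent C p T) :=
    (four_mul_accuracyFactor_le p T).trans (pow_le_pow_right₀ one_le_two (Nat.le_add_left _ _))
  calc (config α d C p T hK).accuracy (regretFactor C p T) k b * √T
      ≤ accuracyFactor C p T * 2 ^ k *
          (1 + 2 * 2 ^ k / 2 ^ (b + explorationExponent C p T)) :=
        accuracy_mul_sqrt_le hC hT hK hk
    _ ≤ accuracyFactor C p T * 2 ^ k * (1 + 2 * 2 ^ k / (4 * accuracyFactor C p T)) := by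
      gcongr
    _ = accuracyFactor C p T * 2 ^ k + 4 ^ k / 2 := by
      rw [four_pow_eq_sq]
      field_simp
      ring
    _ ≤ 2 ^ k / 4 * 2 ^ k + 4 ^ k / 2 := by
      gcongr
      linarith
    _ = 3 / 4 * 4 ^ k := by
      rw [four_pow_eq_sq]
      ring

include hC hT in
lemma accuracy_succ_mul_len_le (hj : j + 1 ≤ Nat.log 4 T) :
    (config α d C p T hK).accuracy (regretFactor C p T) (j + 1) b * (config α d C p T hK).len b j ≤
      5 * accuracyFactor C p T * (2 ^ (j + 1) * √T) := by
  have hG : 0 ≤ accuracyFactor C p T := by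
    linarith [three_le_regretFactor p T hC, regretFactor_le_accuracyFactor p T hC]
  have hsqrt : 0 < √(T : ℝ) := Real.sqrt_pos.2 (by exact_mod_cast hT)
  set G := accuracyFactor C p T
  set ε := (config α d C p T hK).accuracy (regretFactor C p T) (j + 1) b
  set m := b + explorationExponent C p T
  have hlen : (blockLen T m j : ℝ) ≤ T := by exact_mod_cast blockLen_le T m j
  have hdiv : (blockLen T m j : ℝ) * 2 ^ j / 2 ^ m ≤ T :=
    (div_le_iff₀' (by positivity)).2 (blockLen_mul_two_pow_le m)
  refine le_of_mul_le_mul_right ?_ hsqrt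
  calc ε * blockLen T m j * √T = ε * √T * blockLen T m j := mul_right_comm _ _ _
    _ ≤ G * 2 ^ (j + 1) * (1 + 2 * 2 ^ (j + 1) / 2 ^ m) * blockLen T m j :=
      mul_le_mul_of_nonneg_right (accuracy_mul_sqrt_le hC hT hK hj) (Nat.cast_nonneg _)
    _ = G * 2 ^ (j + 1) * (blockLen T m j + 4 * (blockLen T m j * 2 ^ j / 2 ^ m)) := by ring
    _ ≤ G * 2 ^ (j + 1) * (T + 4 * T) := by gcongr
    _ = 5 * G * (2 ^ (j + 1) * √T) * √T := by
      rw [← mul_assoc, mul_assoc _ √(T : ℝ), Real.mul_self_sqrt (Nat.cast_nonneg T)]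
      ring

include hC in
lemma thr_config_add_le (hjk : j < k) :
    (config α d C p T hK).thr j + 21 * √T ≤ logBound C p T ^ 3 / 4 * (2 ^ k * √T) := by
  have hZ := thirty_le_logBound p T hC
  have hthr : (config α d C p T hK).thr j ≤
      2 ^ k * (2 * logBound C p T * (logBound C p T ^ 2 / 10)) * √T := by
    have hB := three_le_regretFactor p T hC
    change 2 ^ (j + 1) * (2 * ((blockCount T : ℝ) + 1) *
      (regretFactor C p T * 2 ^ explorationExponent C p T)) * √T ≤ _
    gcongr
    · exact one_le_two
    · exact hjk
    · exact blockCount_add_one_le_logBound p T hC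
    · exact regretFactor_mul_le p T hC
  have hsqrt : √(T : ℝ) ≤ 2 ^ k * √T :=
    le_mul_of_one_le_left (Real.sqrt_nonneg _) (one_le_pow₀ one_le_two)
  have hcube : (30 : ℝ) ^ 3 ≤ logBound C p T ^ 3 := by gcongr
  have hrest : 21 * √(T : ℝ) ≤ logBound C p T ^ 3 / 20 * (2 ^ k * √T) :=
    mul_le_mul (by linarith) hsqrt (Real.sqrt_nonneg _) (by positivity)
  linarith

include hC in
lemma isDetectable_of_mul_len_le (hjk : j < k) {ε D : ℝ} (hε : 0 ≤ ε) (hD : 2 ^ k ≤ D)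
    (h : ε * (config α d C p T hK).len b j ≤ logBound C p T * (D * √T)) :
    IsDetectable P L (config α d C p T hK) T b j ε (logBound C p T ^ 3 * (D * √T)) := by
  have hZ := thirty_le_logBound p T hC
  refine ⟨1, ε, zero_le_one, hε, fun s => by linarith, ?_⟩
  have hthr := thr_config_add_le (α := α) (d := d) (p := p) (T := T) hC hK hjk
  have hD' : logBound C p T ^ 3 / 4 * (2 ^ k * √T) ≤ logBound C p T ^ 3 / 4 * (D * √T) := by
    gcongr
  have hpow : logBound C p T * 30 ^ 2 ≤ logBound C p T ^ 3 := by
    rw [pow_succ' _ 2]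
    gcongr
  have hnonneg : 0 ≤ D * √T := mul_nonneg ((by positivity : (0 : ℝ) ≤ 2 ^ k).trans hD)
    (Real.sqrt_nonneg _)
  have hlen := mul_le_mul_of_nonneg_right hpow hnonneg
  have hpos : 0 ≤ logBound C p T * (D * √T) := by positivity
  linarith

include hC in
lemma isDetectable_of_two_mul_le_roundRegret (hjk : j < k) {ε : ℝ}
    (h : ∀ s, 2 * ε ≤ roundRegret P (armLearner α d hK j) (L (armLearner α d hK j)) s) :
    IsDetectable P L (config α d C p T hK) T b j ε (logBound C p T ^ 3 * (2 ^ k * √T)) := by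
  have hZ := thirty_le_logBound p T hC
  refine ⟨2, 0, zero_le_two, le_rfl, fun s => ?_, ?_⟩
  · have hs : 2 * ε ≤ roundRegret P ((config α d C p T hK).rep j) _ s := h s
    linarith
  have hthr := thr_config_add_le (α := α) (d := d) (p := p) (T := T) hC hK hjk
  have hpos : 0 ≤ logBound C p T ^ 3 * (2 ^ k * √T) := by positivity
  linarith

include hC hT in
lemma isDetectable_accuracy (hk : k ≤ Nat.log 4 T) (hjk : j < k) :
    IsDetectable P L (config α d C p T hK) T b j
      ((config α d C p T hK).accuracy (regretFactor C p T) k b)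
      (logBound C p T ^ 3 * (4 ^ k * √T)) := by
  have hε := accuracy_nonneg (α := α) (d := d) (p := p) (T := T) hC hK (b := b) (k := k)
  refine isDetectable_of_mul_len_le hC hK hjk hε (by gcongr; norm_num) ?_
  have hG : 0 ≤ accuracyFactor C p T := by
    linarith [three_le_regretFactor p T hC, regretFactor_le_accuracyFactor p T hC]
  have hZ := ten_mul_accuracyFactor_le_logBound p T hC
  set ε := (config α d C p T hK).accuracy (regretFactor C p T) k b
  calc ε * (config α d C p T hK).len b j ≤ ε * T := by
        gcongr
        exact blockLen_le _ _ _
    _ = ε * √T * √T := by rw [mul_assoc, Real.mul_self_sqrt (Nat.cast_nonneg T)]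
    _ ≤ 3 * accuracyFactor C p T * 4 ^ k * √T :=
      mul_le_mul_of_nonneg_right (accuracy_mul_sqrt_le_four_pow hC hT hK hk) (Real.sqrt_nonneg _)
    _ ≤ logBound C p T * 4 ^ k * √T := by
      gcongr
      linarith
    _ = logBound C p T * (4 ^ k * √T) := mul_assoc _ _ _

section Gap

variable (hα : 0 ≤ α) (hgap : P.Gap α T)

lemma le_roundRegret {i : Fin K} {δ : ℝ} (h : ∀ x a, δ ≤ P.mean i x a - P.best x)
    (s : (L i).State) : δ ≤ roundRegret P i (L i) s := by
  have hmono := integral_mono (μ := soloPlay P (L i) s) (integrable_const δ)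
    (integrable_of_abs_le (measurable_mean_sub_best P i) fun _ => P.abs_mean_sub_best_le i _ _)
    fun z => h z.1 z.2
  simpa [roundRegret] using hmono

lemma four_pow_bestArm_le_gap (hj : firstArm α d ≤ j) (hjk : j + 1 < P.bestArm α) :
    3 / 2 * 4 ^ P.bestArm α ≤
      2 * ((d P.iStar : ℝ) ^ (2 * α) - (d (armLearner α d hK j) : ℝ) ^ (2 * α)) := by
  have hsq (n : ℕ) : (n : ℝ) ^ (2 * α) = ((n : ℝ) ^ α) ^ 2 := by
    rw [mul_comm, Real.rpow_mul (by positivity)]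
    norm_cast
  have hbest : (2 ^ P.bestArm α) ^ 2 ≤ ((d P.iStar : ℝ) ^ α) ^ 2 := by
    gcongr
    exact Problem.two_pow_bestArm_le (by omega)
  have hpow : (2 : ℝ) ^ (j + 1) * 2 ≤ 2 ^ P.bestArm α := by
    rw [← pow_succ]
    exact pow_le_pow_right₀ one_le_two hjk
  have harm : ((d (armLearner α d hK j) : ℝ) ^ α) ^ 2 ≤ (2 ^ P.bestArm α / 2) ^ 2 := by
    gcongr
    linarith [armLearner_lt_of_firstArm_le hK hj]
  rw [hsq, hsq, four_pow_eq_sq]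
  linarith

include hC hT hα hgap

lemma two_mul_accuracy_le_roundRegret (hk : P.bestArm α ≤ Nat.log 4 T) (hj : firstArm α d ≤ j)
    (hjk : j + 1 < P.bestArm α) (hlarge : 4 * accuracyFactor C p T ≤ 2 ^ P.bestArm α)
    (s : (L (armLearner α d hK j)).State) :
    2 * (config α d C p T hK).accuracy (regretFactor C p T) (P.bestArm α) b ≤
      roundRegret P (armLearner α d hK j) (L (armLearner α d hK j)) s := by
  have hsqrt : 0 < √(T : ℝ) := Real.sqrt_pos.2 (by exact_mod_cast hT)
  have hmis := Problem.armLearner_lt_iStar (P := P) hα hK hj (by omega)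
  refine le_trans ((le_div_iff₀ hsqrt).2 ?_) (le_roundRegret (hgap _ hmis) s)
  linarith [accuracy_mul_sqrt_le_of_accuracyFactor_le (α := α) (d := d) (b := b) hC hT hK hk hlarge,
    four_pow_bestArm_le_gap (P := P) hK hj hjk]

lemma isDetectable_accuracy_of_gap (hk : P.bestArm α ≤ Nat.log 4 T) (hj : firstArm α d ≤ j)
    (hjk : j < P.bestArm α) :
    IsDetectable P L (config α d C p T hK) T b j
      ((config α d C p T hK).accuracy (regretFactor C p T) (P.bestArm α) b)
      (logBound C p T ^ 4 * (2 ^ P.bestArm α * √T)) := by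
  have hZ := thirty_le_logBound p T hC
  have hG := ten_mul_accuracyFactor_le_logBound p T hC
  have hpow : logBound C p T ^ 3 * (2 ^ P.bestArm α * √T) ≤
      logBound C p T ^ 4 * (2 ^ P.bestArm α * √T) := by
    gcongr
    · linarith
    · norm_num
  rcases lt_or_ge ((2 : ℝ) ^ P.bestArm α) (4 * accuracyFactor C p T) with hsmall | hlarge
  · refine (isDetectable_accuracy hC hT hK hk hjk).mono ?_
    calc logBound C p T ^ 3 * (4 ^ P.bestArm α * √T)
        = logBound C p T ^ 3 * (2 ^ P.bestArm α * (2 ^ P.bestArm α * √T)) := by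
          rw [four_pow_eq_sq, sq, mul_assoc (2 ^ P.bestArm α)]
      _ ≤ logBound C p T ^ 3 * (logBound C p T * (2 ^ P.bestArm α * √T)) := by
          gcongr
          linarith
      _ = logBound C p T ^ 4 * (2 ^ P.bestArm α * √T) := by ring
  rcases Nat.lt_or_ge (j + 1) (P.bestArm α) with hlt | hge
  · exact (isDetectable_of_two_mul_le_roundRegret hC hK hjk fun s =>
      two_mul_accuracy_le_roundRegret hC hT hK hα hgap hk hj hlt hlarge s).mono hpow
  · have hsucc : j + 1 = P.bestArm α := by omega
    refine (isDetectable_of_mul_len_le hC hK hjk (accuracy_nonneg hC hK) le_rfl ?_).mono hpow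
    rw [← hsucc] at hk ⊢
    refine (accuracy_succ_mul_len_le hC hT hK hk).trans ?_
    gcongr
    linarith

end Gap

end Detection

/-! ### The regret of the strategy -/

section CorralRegret

variable {X : Type u} {A : Type v} [MeasurableSpace X] [MeasurableSpace A] {K : ℕ} {d : Fin K → ℕ}
  {P : Problem X A d} {L : Fin K → BaseLearner.{u, v, w} X A} {α C : ℝ} {p T : ℕ}

lemma mul_blockCost_le (hC : 0 < C) (k : ℕ) :
    ((blockCount T : ℝ) + 1) *
      blockCost T (regretFactor C p T) (2 ^ explorationExponent C p T) k ≤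
      logBound C p T ^ 3 * (2 ^ k * √T) := by
  have hZ := thirty_le_logBound p T hC
  have hB := three_le_regretFactor p T hC
  have hprod : 2 * (regretFactor C p T * 2 ^ explorationExponent C p T + 1) ≤
      logBound C p T ^ 2 := by
    have : (30 : ℝ) ^ 2 ≤ logBound C p T ^ 2 := by gcongr
    linarith [regretFactor_mul_le p T hC]
  calc ((blockCount T : ℝ) + 1) *
        blockCost T (regretFactor C p T) (2 ^ explorationExponent C p T) k
      = ((blockCount T : ℝ) + 1) *
          (2 * (regretFactor C p T * 2 ^ explorationExponent C p T + 1)) * (2 ^ k * √T) := by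
        rw [blockCost]
        ring
    _ ≤ logBound C p T * logBound C p T ^ 2 * (2 ^ k * √T) := by
        gcongr
        exact blockCount_add_one_le_logBound p T hC
    _ = logBound C p T ^ 3 * (2 ^ k * √T) := by ring

lemma logBound_mul_add_le (hC : 0 < C) {y : ℝ} (hy : 1 ≤ y) :
    logBound C p T * (logBound C p T ^ 3 * y + logBound C p T * (logBound C p T ^ 4 * y) + 1) +
      logBound C p T ^ 3 * y ≤ 2 * logBound C p T ^ 6 * y := by
  have hZ := thirty_le_logBound p T hC
  set Z := logBound C p T
  have hpow {m : ℕ} (hm : m ≤ 5) : 30 * Z ^ m * y ≤ Z ^ 6 * y := by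
    rw [pow_succ' _ 5]
    gcongr
    linarith
  have hone : Z * 1 ≤ Z ^ 1 * y := by
    rw [pow_one]
    gcongr
  linarith [hpow (m := 4) (by norm_num), hpow (m := 3) (by norm_num), hpow (m := 1) (by norm_num)]

lemma HasRegretBound.corralRegret_le_of_isDetectable_of_le_log (h : HasRegretBound P L α C p T)
    (hC : 0 < C) (hT : 1 ≤ T) (hK : 0 < K) (hk : P.bestArm α ≤ Nat.log 4 T) {D : ℝ}
    (hD : 2 ^ P.bestArm α ≤ D)
    (hdet : ∀ b j, firstArm α d ≤ b → b ≤ j → j < P.bestArm α →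
      IsDetectable P L (config α d C p T hK) T b j
        ((config α d C p T hK).accuracy (regretFactor C p T) (P.bestArm α) b)
        (logBound C p T ^ 4 * (D * √T))) :
    corralRegret P L (config α d C p T hK).rule.strategy T ≤
      2 * logBound C p T ^ 6 * (D * √T) := by
  have hcal := h.calibrated hC hT hK
  have hZ := thirty_le_logBound p T hC
  have hQ := blockCount_add_one_le_logBound p T hC
  have hD' : 2 ^ P.bestArm α * √T ≤ D * √T := mul_le_mul_of_nonneg_right hD (Real.sqrt_nonneg _)
  have hy : 1 ≤ D * √T :=
    (one_le_mul_of_one_le_of_one_le (one_le_pow₀ one_le_two) hcal.one_le_sqrt).trans hD'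
  have hcost_nonneg := hcal.blockCost_nonneg (P.bestArm α)
  have hcost : ((blockCount T : ℝ) + 1) * blockCost T (regretFactor C p T)
      (2 ^ explorationExponent C p T) (P.bestArm α) ≤ logBound C p T ^ 3 * (D * √T) :=
    (mul_blockCost_le hC _).trans (by gcongr)
  have hphases : ((P.bestArm α - firstArm α d : ℕ) : ℝ) ≤ logBound C p T := by
    have hle : P.bestArm α - firstArm α d ≤ blockCount T :=
      (Nat.sub_le _ _).trans (hk.trans (Nat.le_mul_of_pos_left _ (Nat.succ_pos _)))
    have : ((P.bestArm α - firstArm α d : ℕ) : ℝ) ≤ blockCount T := by exact_mod_cast hle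
    linarith
  rw [corralRegret_strategy]
  refine (hcal.restartValue_phaseStart_le hk (by positivity) hdet le_rfl
    Problem.firstArm_le_bestArm le_rfl).trans (le_trans ?_ (logBound_mul_add_le hC hy))
  gcongr

variable (T) in
lemma two_mul_logBound_pow : 2 * logBound C p T ^ 6 =
    2 * (80 * (C + 1)) ^ 6 * (1 + Real.log T) ^ (6 * (p + 2)) := by
  rw [logBound, mul_pow, ← pow_mul, mul_comm (p + 2)]
  ring

lemma Problem.two_pow_bestArm_mul_le (hK : 0 < K) (n : ℕ) {y : ℝ} (hy : 0 ≤ y) :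
    (2 ^ P.bestArm α) ^ n * y ≤ ((d P.iStar : ℝ) ^ α) ^ n * y + K * y := by
  have hK' : (1 : ℝ) ≤ K := by exact_mod_cast hK
  rcases Nat.eq_zero_or_pos (P.bestArm α) with hzero | hpos
  · rw [hzero, pow_zero, one_pow]
    exact (mul_le_mul_of_nonneg_right hK' hy).trans (le_add_of_nonneg_left (by positivity))
  · refine le_trans ?_ (le_add_of_nonneg_right (by positivity))
    gcongr
    exact two_pow_bestArm_le hpos

lemma Problem.horizon_le_of_log_lt_bestArm {n : ℕ} (hn : n ≠ 0)
    (hk : Nat.log 4 T < P.bestArm α) : T ≤ ((d P.iStar : ℝ) ^ α) ^ n * √T := by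
  have hdim := two_pow_bestArm_le (P := P) (α := α) (by omega)
  have hsqrt : √(T : ℝ) ≤ (d P.iStar : ℝ) ^ α :=
    (sqrt_le_two_pow_log_succ T).trans ((pow_le_pow_right₀ one_le_two hk).trans hdim)
  calc (T : ℝ) = √T * √T := (Real.mul_self_sqrt (Nat.cast_nonneg T)).symm
    _ ≤ ((d P.iStar : ℝ) ^ α) ^ n * √T := by
      gcongr
      exact hsqrt.trans (le_self_pow₀ ((one_le_pow₀ one_le_two).trans hdim) hn)

lemma HasRegretBound.corralRegret_le_of_isDetectable (h : HasRegretBound P L α C p T)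
    (hC : 0 < C) (hT : 1 ≤ T) (hK : 0 < K) {n : ℕ} (hn : n ≠ 0)
    (hdet : P.bestArm α ≤ Nat.log 4 T → ∀ b j, firstArm α d ≤ b → b ≤ j → j < P.bestArm α →
      IsDetectable P L (config α d C p T hK) T b j
        ((config α d C p T hK).accuracy (regretFactor C p T) (P.bestArm α) b)
        (logBound C p T ^ 4 * ((2 ^ P.bestArm α) ^ n * √T))) :
    corralRegret P L (config α d C p T hK).rule.strategy T ≤ 2 * (80 * (C + 1)) ^ 6 *
      (((d P.iStar : ℝ) ^ α) ^ n * √T + K * √T) * (1 + Real.log T) ^ (6 * (p + 2)) := by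
  have hZ := thirty_le_logBound p T hC
  rw [mul_right_comm, ← two_mul_logBound_pow]
  rcases le_or_gt (P.bestArm α) (Nat.log 4 T) with hk | hk
  · refine (h.corralRegret_le_of_isDetectable_of_le_log hC hT hK hk
      (le_self_pow₀ (one_le_pow₀ one_le_two) hn) (hdet hk)).trans ?_
    gcongr
    exact Problem.two_pow_bestArm_mul_le hK n (Real.sqrt_nonneg _)
  · have hfactor : 1 ≤ 2 * logBound C p T ^ 6 := by
      have : 1 ≤ logBound C p T ^ 6 := one_le_pow₀ (by linarith)
      linarith
    rw [corralRegret_strategy]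
    calc restartValue P L (config α d C p T hK).rule T (config α d C p T hK).rule.start
        ≤ T := restartValue_le P L _ T _
      _ ≤ ((d P.iStar : ℝ) ^ α) ^ n * √T + K * √T :=
        (Problem.horizon_le_of_log_lt_bestArm hn hk).trans
          (le_add_of_nonneg_right (by positivity))
      _ ≤ _ := le_mul_of_one_le_left (by positivity) hfactor

theorem HasRegretBound.corralRegret_le (h : HasRegretBound P L α C p T)
    (hC : 0 < C) (hT : 1 ≤ T) (hK : 0 < K) :
    corralRegret P L (config α d C p T hK).rule.strategy T ≤ 2 * (80 * (C + 1)) ^ 6 *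
      ((d P.iStar : ℝ) ^ (2 * α) * √T + K * √T) * (1 + Real.log T) ^ (6 * (p + 2)) := by
  rw [mul_comm 2 α, Real.rpow_mul (Nat.cast_nonneg _), Real.rpow_ofNat]
  refine h.corralRegret_le_of_isDetectable hC hT hK two_ne_zero fun hk b j _ _ hjk =>
    (isDetectable_accuracy hC hT hK hk hjk).mono ?_
  have hZ := thirty_le_logBound p T hC
  rw [four_pow_eq_sq]
  gcongr
  · linarith
  · norm_num

theorem HasRegretBound.corralRegret_le_of_gap (h : HasRegretBound P L α C p T) (hα : 0 ≤ α)
    (hC : 0 < C) (hT : 1 ≤ T) (hK : 0 < K) (hgap : P.Gap α T) :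
    corralRegret P L (config α d C p T hK).rule.strategy T ≤ 2 * (80 * (C + 1)) ^ 6 *
      ((d P.iStar : ℝ) ^ α * √T + K * √T) * (1 + Real.log T) ^ (6 * (p + 2)) := by
  have hle := h.corralRegret_le_of_isDetectable hC hT hK one_ne_zero fun hk b j hb hbj hjk => by
    rw [pow_one]
    exact isDetectable_accuracy_of_gap hC hT hK hα hgap hk (hb.trans hbj) hjk
  rwa [pow_one] at hle

end CorralRegret

end ModelSelection

end

theorem theorem7 (α : ℝ) (hα : 0 ≤ α) (C : ℝ) (hC : 0 < C) (p : ℕ) :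
    ∃ (C' : ℝ) (p' : ℕ), ∀ (T K : ℕ) (d : Fin K → ℕ), 0 < K →
      ∃ S : ModelSelection.Strategy K,
        ∀ (X : Type u) (A : Type v) [MeasurableSpace X] [MeasurableSpace A]
          (P : ModelSelection.Problem X A d)
          (L : Fin K → ModelSelection.BaseLearner.{u, v, w} X A),
          (∀ i, P.iStar ≤ i → ∀ t ≤ T,
            ModelSelection.soloRegret P i (L i) t
              ≤ C * (d i : ℝ) ^ α * √t * (1 + Real.log T) ^ p) →
          ModelSelection.corralRegret P L S T
              ≤ C' * ((d P.iStar : ℝ) ^ (2 * α) * √T + K * √T) * (1 + Real.log T) ^ p' ∧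
          (P.Gap α T →
            ModelSelection.corralRegret P L S T
              ≤ C' * ((d P.iStar : ℝ) ^ α * √T + K * √T) * (1 + Real.log T) ^ p') := by
  refine ⟨2 * (80 * (C + 1)) ^ 6, 6 * (p + 2), fun T K d hK =>
    ⟨(ModelSelection.config α d C p T hK).rule.strategy, fun X A _ _ P L hL => ?_⟩⟩
  rcases Nat.eq_zero_or_pos T with rfl | hT
  · simp [ModelSelection.corralRegret]
  have hL' : ModelSelection.HasRegretBound P L α C p T := hL
  exact ⟨hL'.corralRegret_le hC hT hK, hL'.corralRegret_le_of_gap hα hC hT hK⟩
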